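/- Let $\pi$ and $q$ be probability measures on a measurable space $\mathbb{X}$ such that $\pi$ is absolutely continuous with respect to $q$, and let the weight $\omega=d\pi/dq$ be positive $q$-almost everywhere. Let $f:\mathbb{X}\to\mathbb{R}$ be measurable and write $\mu(g)=\int g\,d\mu$ for a measure $\mu$. For $N\ge 1$ and $\mathbf{x}=(x_1,\dots,x_N)\in\mathbb{X}^N$ put $$\hat Z(\mathbf{x})=\frac1N\sum_{n=1}^N\omega(x_n),\qquad \hat F(\mathbf{x})=\frac{\sum_{n=1}^N\omega(x_n)f(x_n)}{\sum_{n=1}^N\omega(x_n)},$$ and let $\bar q=q^{\otimes N}$. Draw independently $\mathbf{x}_0\sim\bar q$, $\mathbf{y}_0\sim\bar q$, $\mathbf{x}^\star_t\sim\bar q$ for $t\ge1$, and $u_t\sim\mathrm{Uniform}(0,1)$ for $t\ge0$. Set $\mathbf{x}_1=\mathbf{y}_0$ if $u_0<\hat Z(\mathbf{y}_0)/\hat Z(\mathbf{x}_0)$ and $\mathbf{x}_1=\mathbf{x}_0$ otherwise. For $t\ge1$, set $\mathbf{x}_{t+1}=\mathbf{x}^\star_t$ if $u_t<\hat Z(\mathbf{x}^\star_t)/\hat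 Z(\mathbf{x}_t)$ and $\mathbf{x}_{t+1}=\mathbf{x}_t$ otherwise, and set $\mathbf{y}_t=\mathbf{x}^\star_t$ if $u_t<\hat Z(\mathbf{x}^\star_t)/\hat Z(\mathbf{y}_{t-1})$ and $\mathbf{y}_t=\mathbf{y}_{t-1}$ otherwise. Let $\tau=\inf\{t\ge1:\mathbf{x}_t=\mathbf{y}_{t-1}\}$ and define the unbiased importance sampling (UIS) estimator $$\hat F_u=\hat F(\mathbf{x}_0)+\sum_{t=1}^{\tau-1}\{\hat F(\mathbf{x}_t)-\hat F(\mathbf{y}_{t-1})\}.$$ **(i)** Let $p\in(2,\infty)$, $r\in[2,\infty)$ and $2\le s<p$ satisfy $\frac{pr}{p+r+2}>\frac{ps}{p-s}$. If $q(\omega^p)<\infty$, $q(|f|^r)<\infty$ and $q(f^2\omega^2)<\infty$, then for every $N\ge1$ the meeting time $\tau$ is almost surely finite, $|\hat F_u-\pi(f)|^s$ is integrable, and $$\mathbb{E}\left[|\hat F_u-\pi(f)|^s\right]\le C N^{-s/2},$$ where $C$ depends only on $p,r,s,q(|f|^r),q(\omega^p)$ and $q(f^2\omega^2)$. **(ii)**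 (Case $r=\infty$.) Let $p\in(2,\infty)$ and $0<s<p$ satisfy $p>\frac{sp}{p-s}$. If $q(\omega^p)<\infty$ and $|f|\le B$ $q$-almost everywhere for some constant $B$, then for every $N\ge1$ the same conclusions hold, with $C$ depending only on $p,s,B,q(\omega^p)$ and $q(f^2\omega^2)$. -/

import Mathlib

open MeasureTheory ProbabilityTheory

/-- `w` is a version of the importance weight `dπ/dq`, positive `q`-almost everywhere.
In particular `π` is absolutely continuous with respect to `q`. -/
structure IsImportanceWeight {X : Type*} [MeasurableSpace X] (π q : Measure X) (w : X → ℝ) :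
    Prop where
  measurable : Measurable w
  pos : ∀ᵐ x ∂q, 0 < w x
  density : π = q.withDensity (fun x => ENNReal.ofReal (w x))

/-- The average weight `Ẑ(x) = N⁻¹ ∑ₙ w(xₙ)`. -/
noncomputable def avgWeight {X : Type*} {N : ℕ} (w : X → ℝ) (x : Fin N → X) : ℝ :=
  (N : ℝ)⁻¹ * ∑ n, w (x n)

/-- The self-normalized importance sampling estimator
`F̂(x) = ∑ₙ w(xₙ) f(xₙ) / ∑ₙ w(xₙ)`. -/
noncomputable def snis {X : Type*} {N : ℕ} (w f : X → ℝ) (x : Fin N → X) : ℝ :=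
  (∑ n, w (x n) * f (x n)) / ∑ n, w (x n)

/-- One particle independent Metropolis-Hastings (PIMH) step from `x`, with proposal `x'` and
uniform draw `u`. -/
noncomputable def pimhStep {X : Type*} {N : ℕ} (w : X → ℝ) (x x' : Fin N → X) (u : ℝ) :
    Fin N → X :=
  if u < avgWeight w x' / avgWeight w x then x' else x

/-- One step of the common draws coupling: both chains use the same proposal and the same
uniform draw. -/
noncomputable def coupledStep {X : Type*} {N : ℕ} (w : X → ℝ) (s : (Fin N → X) × (Fin N → X))
    (x' : Fin N → X) (u : ℝ) : (Fin N → X) × (Fin N → X) :=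
  (pimhStep w s.1 x' u, pimhStep w s.2 x' u)

/-- The pair `(x_{t+1}, y_t)` of the coupled PIMH chains with lag one. The draws are
`x_0 = z 0`, `y_0 = z 1`; the first step `x_0 → x_1` uses `y_0` as its proposal and the uniform
`u 0`; afterwards both chains move by the common draws coupling, with the fresh proposal
`z (t + 2)` and the uniform `u (t + 1)`. -/
noncomputable def laggedPair {X : Type*} {N : ℕ} (w : X → ℝ) (z : ℕ → Fin N → X) (u : ℕ → ℝ) :
    ℕ → (Fin N → X) × (Fin N → X)
  | 0 => (pimhStep w (z 0) (z 1) (u 0), z 1)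
  | t + 1 => coupledStep w (laggedPair w z u t) (z (t + 2)) (u (t + 1))

/-- The leading chain `(x_t)`. -/
noncomputable def chainX {X : Type*} {N : ℕ} (w : X → ℝ) (z : ℕ → Fin N → X) (u : ℕ → ℝ) :
    ℕ → Fin N → X
  | 0 => z 0
  | t + 1 => (laggedPair w z u t).1

/-- The lagging chain `(y_t)`. -/
noncomputable def chainY {X : Type*} {N : ℕ} (w : X → ℝ) (z : ℕ → Fin N → X) (u : ℕ → ℝ)
    (t : ℕ) : Fin N → X :=
  (laggedPair w z u t).2

/-- The meeting time `τ = inf {t ≥ 1 : x_t = y_{t-1}}`, equal to `⊤` if the chains never meet. -/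
noncomputable def meetingTime {X : Type*} {N : ℕ} (w : X → ℝ) (z : ℕ → Fin N → X)
    (u : ℕ → ℝ) : ℕ∞ :=
  ⨅ (t : ℕ) (_ : 1 ≤ t ∧ chainX w z u t = chainY w z u (t - 1)), (t : ℕ∞)

/-- The unbiased importance sampling estimator
`F̂_u = F̂(x_0) + ∑_{t=1}^{τ-1} {F̂(x_t) - F̂(y_{t-1})}`
(the value on the event `τ = ⊤` is irrelevant). -/
noncomputable def uis {X : Type*} {N : ℕ} (w f : X → ℝ) (z : ℕ → Fin N → X) (u : ℕ → ℝ) : ℝ :=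
  snis w f (chainX w z u 0) +
    ∑ t ∈ Finset.Ico 1 (meetingTime w z u).toNat,
      (snis w f (chainX w z u t) - snis w f (chainY w z u (t - 1)))

/-- The random input of the algorithm: `z 0, z 1, …` are draws of `N` independent particles from
`q`, `u 0, u 1, …` are uniform on `(0, 1)`, and all of them are mutually independent. -/
structure IsUISInput {X Ω : Type*} [MeasurableSpace X] [MeasurableSpace Ω] {N : ℕ}
    (q : Measure X) (P : Measure Ω) (z : ℕ → Ω → Fin N → X) (u : ℕ → Ω → ℝ) : Prop where
  measurable_z : ∀ t, Measurable (z t)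
  measurable_u : ∀ t, Measurable (u t)
  law_z : ∀ t, P.map (z t) = Measure.pi (fun _ => q)
  law_u : ∀ t, P.map (u t) = volume.restrict (Set.Ioo 0 1)
  indep_z : iIndepFun z P
  indep_u : iIndepFun u P
  indep_z_u : IndepFun (fun ω t => z t ω) (fun ω t => u t ω) P

open scoped ENNReal

/-! ### Elementary inequalities -/

/-! While the leading chain rejects, every proposal seen so far is lighter than `z 0`, so the
lagging chain sits at a state no heavier than `z 0`. The first proposal accepted by the leading
chain is therefore accepted by the lagging one as well, and the chains meet. With `T` the number of
initial rejections, `c = π(f)` and `G = F̂ - c`, the error is exactly `(T + 1) G(x₀) - ∑_{k < T}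
G(y_k)`.

Grouping the sum by the state of the lagging chain bounds it by a series over `j`: on the event that
the leading chain has not moved during its first `j` steps, `|G (z (j + 1))|` times the sojourn
started at `z (j + 1)` (`enorm_uis_sub_le`). The event involves only draws before those of the
sojourn, hence is independent of it. Minkowski's inequality then bounds the `L^s` norm of the error
by that of a single sojourn contribution, times a constant plus the sum of the `s`-th roots of the
waiting probabilities.

At a state of weight `a` each proposal is accepted with probability at least `κ min(1, 1/a)`, with
`κ` independent of `N`. Sojourns thus have geometric tails, and two facts follow. A sojourn
contribution costs at most a constant times `E(|G|^s + |Ẑ G|^s)`. The waiting probabilities are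
`O(j^{-p})`, by the `p`-th moment of the weight, so that their `s`-th roots are summable because `s
< p`.

It remains to show `E(|G|^s + |Ẑ G|^s) = O(N^{-s/2})` (`integral_abs_snis_sub_rpow_le`). The product
`Ẑ G` is an average of centred independent terms, to which a Marcinkiewicz–Zygmund inequality
applies. For `G` alone the danger is a small `Ẑ`, which is improbable by the same inequality for `Ẑ
- 1`; there a truncation of `G` is balanced against its `r`-th moment. -/

lemma Real.rpow_sub_rpow_le {k x y : ℝ} (hk : 1 ≤ k) (hx : 0 ≤ x) (hxy : x ≤ y) :
    y ^ k - x ^ k ≤ k * y ^ (k - 1) * (y - x) := by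
  rcases (hx.trans hxy).eq_or_lt with rfl | hy
  · obtain rfl : x = 0 := le_antisymm hxy hx
    simp
  have h := one_add_mul_self_le_rpow_one_add (s := (x - y) / y)
    (by rw [le_div_iff₀ hy]; linarith) hk
  have e : 1 + (x - y) / y = x / y := by field_simp; ring
  rw [e, Real.div_rpow hx hy.le, le_div_iff₀ (by positivity)] at h
  have e2 : y ^ k = y ^ (k - 1) * y := by
    rw [← Real.rpow_add_one hy.ne']; congr 1; ring
  have : (1 + k * ((x - y) / y)) * y ^ k = y ^ k + k * y ^ (k - 1) * (x - y) := by
    rw [e2]; field_simp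
  nlinarith

/-- The derivative of `t ↦ |t| ^ m * t` is `(m + 1) |t| ^ m`. Equal signs reduce to the tangent
bound for the power `m + 1`; for opposite signs both sides split into separate contributions of `x`
and `y`. With `m = s - 2` this stands in for a bound on the second derivative of `|·| ^ s`. -/
lemma abs_rpow_mul_self_sub_le {m x y R : ℝ} (hm : 0 ≤ m) (hx : |x| ≤ R) (hy : |y| ≤ R) :
    |(|x| ^ m * x - |y| ^ m * y)| ≤ (m + 1) * R ^ m * |x - y| := by
  have key : ∀ a b : ℝ, 0 ≤ a → a ≤ b → b ≤ R →
      b ^ m * b - a ^ m * a ≤ (m + 1) * R ^ m * (b - a) ∧ 0 ≤ b ^ m * b - a ^ m * a := by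
    intro a b ha hab hb
    have hb0 := ha.trans hab
    have h := Real.rpow_sub_rpow_le (k := m + 1) (by linarith) ha hab
    rw [Real.rpow_add_one' hb0 (by linarith), Real.rpow_add_one' ha (by linarith)] at h
    rw [add_sub_cancel_right] at h
    refine ⟨h.trans ?_, ?_⟩
    · have : b ^ m ≤ R ^ m := Real.rpow_le_rpow hb0 hb hm
      have : 0 ≤ b - a := by linarith
      gcongr
    · have : a ^ m ≤ b ^ m := Real.rpow_le_rpow ha hab hm
      have : a ^ m * a ≤ b ^ m * b := by gcongr
      linarith
  have same : ∀ a b : ℝ, 0 ≤ a → 0 ≤ b → a ≤ R → b ≤ R →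
      |(a ^ m * a - b ^ m * b)| ≤ (m + 1) * R ^ m * |a - b| := by
    intro a b ha hb haR hbR
    rcases le_total a b with h | h
    · obtain ⟨h1, h2⟩ := key a b ha h hbR
      rw [abs_sub_comm, abs_of_nonneg h2, abs_sub_comm, abs_of_nonneg (by linarith)]
      exact h1
    · obtain ⟨h1, h2⟩ := key b a hb h haR
      rw [abs_of_nonneg h2, abs_of_nonneg (by linarith)]
      exact h1
  have opp : ∀ a b : ℝ, 0 ≤ a → 0 ≤ b → a ≤ R → b ≤ R →
      a ^ m * a + b ^ m * b ≤ (m + 1) * R ^ m * (a + b) := by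
    intro a b ha hb haR hbR
    have h1 : a ^ m ≤ R ^ m := Real.rpow_le_rpow ha haR hm
    have h2 : b ^ m ≤ R ^ m := Real.rpow_le_rpow hb hbR hm
    have h3 : 0 ≤ R ^ m := Real.rpow_nonneg (ha.trans haR) m
    have h4 : 0 ≤ m * R ^ m * (a + b) := by positivity
    nlinarith [mul_le_mul_of_nonneg_right h1 ha, mul_le_mul_of_nonneg_right h2 hb]
  rcases le_total 0 x with h | h <;> rcases le_total 0 y with h' | h'
  · rw [abs_of_nonneg h] at hx ⊢; rw [abs_of_nonneg h'] at hy ⊢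
    exact same x y h h' hx hy
  · rw [abs_of_nonneg h] at hx ⊢; rw [abs_of_nonpos h'] at hy ⊢
    have := opp x (-y) h (by linarith) hx hy
    have p1 : 0 ≤ x ^ m * x := by positivity
    have p2 : 0 ≤ (-y) ^ m * (-y) := mul_nonneg (Real.rpow_nonneg (by linarith) _) (by linarith)
    rw [abs_of_nonneg (by linarith), abs_of_nonneg (by linarith)]
    linarith
  · rw [abs_of_nonpos h] at hx ⊢; rw [abs_of_nonneg h'] at hy ⊢
    have := opp (-x) y (by linarith) h' hx hy
    have p1 : 0 ≤ y ^ m * y := by positivity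
    have p2 : 0 ≤ (-x) ^ m * (-x) := mul_nonneg (Real.rpow_nonneg (by linarith) _) (by linarith)
    rw [abs_of_nonpos (by linarith), abs_of_nonpos (by linarith)]
    linarith
  · rw [abs_of_nonpos h] at hx ⊢; rw [abs_of_nonpos h'] at hy ⊢
    have := same (-x) (-y) (by linarith) (by linarith) hx hy
    rw [abs_sub_comm]
    rw [abs_sub_comm x y]
    convert this using 2 <;> ring_nf

lemma add_rpow_le_two_rpow_mul {m x y : ℝ} (hm : 0 ≤ m) (hx : 0 ≤ x) (hy : 0 ≤ y) :
    (x + y) ^ m ≤ 2 ^ m * (x ^ m + y ^ m) := by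
  have h1 : (x + y) ^ m ≤ (2 * max x y) ^ m := by
    apply Real.rpow_le_rpow (by positivity) _ hm
    have := le_max_left x y
    have := le_max_right x y
    linarith
  rw [Real.mul_rpow (by norm_num) (hx.trans (le_max_left x y))] at h1
  refine h1.trans ?_
  gcongr
  have hx' := Real.rpow_nonneg hx m
  have hy' := Real.rpow_nonneg hy m
  rcases max_choice x y with h | h <;> rw [h] <;> linarith

/-- Mean value theorem for `t ↦ |a + t b| ^ s` on `[0, 1]`, comparing the derivative at the
intermediate point with the one at `0`. The linear term is kept exact because it has mean zero when
`b` is centred and independent of `a`. -/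
lemma abs_add_rpow_le {s : ℝ} (hs : 2 ≤ s) (a b : ℝ) :
    |a + b| ^ s ≤ |a| ^ s + s * (|a| ^ (s - 2) * a) * b
      + s * (s - 1) * 2 ^ (s - 2) * (|a| ^ (s - 2) * b ^ 2 + |b| ^ s) := by
  have hd : ∀ t : ℝ, HasDerivAt (fun t : ℝ => |a + t * b| ^ s)
      (s * |a + t * b| ^ (s - 2) * (a + t * b) * b) t := by
    intro t
    have h1 := hasDerivAt_abs_rpow (a + t * b) (p := s) (by linarith)
    have h2 : HasDerivAt (fun t : ℝ => a + t * b) b t := by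
      simpa using ((hasDerivAt_id t).mul_const b).const_add a
    exact HasDerivAt.comp (h₂ := fun x : ℝ => |x| ^ s) t h1 h2
  obtain ⟨t, ht, h⟩ := exists_hasDerivAt_eq_slope (fun t : ℝ => |a + t * b| ^ s) _ one_pos
    (fun t _ => (hd t).continuousAt.continuousWithinAt) (fun t _ => hd t)
  simp only [one_mul, zero_mul, add_zero, sub_zero, div_one] at h
  have hR1 : |a + t * b| ≤ |a| + |b| := by
    refine (abs_add_le _ _).trans ?_
    rw [abs_mul, abs_of_pos ht.1]
    nlinarith [abs_nonneg b, ht.2]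
  have hl := abs_rpow_mul_self_sub_le (m := s - 2) (by linarith) hR1
    (show |a| ≤ |a| + |b| by linarith [abs_nonneg b])
  have e1 : |a + t * b - a| ≤ |b| := by
    rw [add_sub_cancel_left, abs_mul, abs_of_pos ht.1]
    nlinarith [abs_nonneg b, ht.2]
  have hR0 : 0 ≤ (s - 2 + 1) * (|a| + |b|) ^ (s - 2) := by
    have : 0 ≤ s - 2 + 1 := by linarith
    positivity
  have h3 : (|a + t * b| ^ (s - 2) * (a + t * b) - |a| ^ (s - 2) * a) * b
      ≤ (s - 1) * (|a| + |b|) ^ (s - 2) * b ^ 2 := by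
    refine (le_abs_self _).trans ?_
    rw [abs_mul]
    calc _ ≤ ((s - 2 + 1) * (|a| + |b|) ^ (s - 2) * |b|) * |b| := by
          gcongr
          exact hl.trans (mul_le_mul_of_nonneg_left e1 hR0)
      _ = _ := by rw [mul_assoc, abs_mul_abs_self]; ring
  have h4 : (|a| + |b|) ^ (s - 2) * b ^ 2 ≤ 2 ^ (s - 2) * (|a| ^ (s - 2) * b ^ 2 + |b| ^ s) := by
    have e : |b| ^ s = |b| ^ (s - 2) * b ^ 2 := by
      rw [← sq_abs, ← Real.rpow_natCast, ← Real.rpow_add' (abs_nonneg b) (by norm_num; linarith)]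
      congr 1; norm_num
    rw [e, ← add_mul, ← mul_assoc]
    exact mul_le_mul_of_nonneg_right
      (add_rpow_le_two_rpow_mul (by linarith) (abs_nonneg a) (abs_nonneg b)) (sq_nonneg b)
  have hs0 : 0 ≤ s * (s - 1) := mul_nonneg (by linarith) (by linarith)
  have h5 := mul_le_mul_of_nonneg_left h3 (show 0 ≤ s by linarith)
  have h6 := mul_le_mul_of_nonneg_left h4 hs0
  linarith

lemma rpow_le_one_add_rpow {x a b : ℝ} (hx : 0 ≤ x) (ha : 0 ≤ a) (hab : a ≤ b) :
    x ^ a ≤ 1 + x ^ b := by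
  rcases le_total x 1 with h | h
  · linarith [Real.rpow_le_one hx h ha, Real.rpow_nonneg hx b]
  · linarith [Real.rpow_le_rpow_of_exponent_le h hab]

/-! ### Moments -/

section Moments

variable {Ω : Type*} [MeasurableSpace Ω] {P : Measure Ω}

lemma integrable_abs_rpow_of_le [IsFiniteMeasure P] {g : Ω → ℝ} {a b : ℝ}
    (ha : 0 ≤ a) (hab : a ≤ b) (h : Integrable (fun x => |g x| ^ b) P) :
    Integrable (fun x => |g x| ^ a) P := by
  rcases ha.eq_or_lt with rfl | ha'
  · simp
  have hb : b ≠ 0 := by linarith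
  have e : (fun x => |g x| ^ a) = fun x => (|g x| ^ b) ^ (a / b) := by
    ext x; rw [← Real.rpow_mul (abs_nonneg _), mul_div_cancel₀ a hb]
  refine ((integrable_const (1 : ℝ)).add h).mono' ?_ (ae_of_all _ fun x => ?_)
  · rw [e]
    exact (h.aestronglyMeasurable.aemeasurable.pow_const _).aestronglyMeasurable
  rw [Real.norm_of_nonneg (by positivity)]
  exact rpow_le_one_add_rpow (abs_nonneg _) ha hab

lemma integrable_abs_add_rpow {g h : Ω → ℝ} (hg : Measurable g) (hh : Measurable h) {a : ℝ}
    (ha : 0 ≤ a) (ig : Integrable (fun x => |g x| ^ a) P) (ih : Integrable (fun x => |h x| ^ a) P) :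
    Integrable (fun x => |g x + h x| ^ a) P := by
  refine ((ig.add ih).const_mul (2 ^ a)).mono' (by fun_prop) (ae_of_all _ fun x => ?_)
  rw [Real.norm_of_nonneg (by positivity)]
  refine le_trans ?_ (add_rpow_le_two_rpow_mul ha (abs_nonneg _) (abs_nonneg _))
  exact Real.rpow_le_rpow (abs_nonneg _) (abs_add_le _ _) ha

lemma integral_rpow_le_rpow_integral [IsProbabilityMeasure P] {g : Ω → ℝ} {θ : ℝ}
    (h0 : 0 ≤ θ) (h1 : θ ≤ 1) (hg : ∀ x, 0 ≤ g x) (ig : Integrable g P) :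
    ∫ x, g x ^ θ ∂P ≤ (∫ x, g x ∂P) ^ θ := by
  refine (Real.concaveOn_rpow h0 h1).le_map_integral
    (Real.continuous_rpow_const h0).continuousOn isClosed_Ici (ae_of_all _ hg) ig ?_
  refine ((integrable_const (1 : ℝ)).add ig).mono'
    (ig.aestronglyMeasurable.aemeasurable.pow_const θ).aestronglyMeasurable
    (ae_of_all _ fun x => ?_)
  simp only [Function.comp, Pi.add_apply]
  rw [Real.norm_of_nonneg (Real.rpow_nonneg (hg x) _)]
  simpa using rpow_le_one_add_rpow (hg x) h0 h1

lemma integral_abs_rpow_le [IsProbabilityMeasure P] {g : Ω → ℝ} {a b : ℝ}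
    (ha : 0 ≤ a) (hab : a ≤ b) (hb : 0 < b) (ig : Integrable (fun x => |g x| ^ b) P) :
    ∫ x, |g x| ^ a ∂P ≤ (∫ x, |g x| ^ b ∂P) ^ (a / b) := by
  have h := integral_rpow_le_rpow_integral (P := P) (g := fun x => |g x| ^ b) (θ := a / b)
    (by positivity) ((div_le_one hb).2 hab) (fun x => by positivity) ig
  simpa only [← Real.rpow_mul (abs_nonneg _), mul_div_cancel₀ a hb.ne'] using h

/-- The numerical recursion behind the induction on the number of summands. The increment is of
order `n ^ (s / 2 - 1)`, and Bernoulli's inequality shows that `n ^ (s / 2)` grows by at least that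
much. -/
lemma marcinkiewicz_zygmund_step {s C K H a : ℝ} {n : ℕ} (hs : 2 ≤ s) (hC : 1 ≤ C)
    (hK : K = (2 * C) ^ (s / 2)) (hH : 0 ≤ H) (ha0 : 0 ≤ a)
    (ha : a ≤ K * (n : ℝ) ^ (s / 2) * H) :
    a + C * (a ^ ((s - 2) / s) * H ^ (2 / s) + H) ≤ K * ((n + 1 : ℕ) : ℝ) ^ (s / 2) * H := by
  have hs0 : 0 < s := by linarith
  have hK1 : 2 * C ≤ K := by
    rw [hK]; nth_rewrite 1 [← Real.rpow_one (2 * C)]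
    exact Real.rpow_le_rpow_of_exponent_le (by linarith) (by linarith)
  have hK0 : 0 < K := by linarith
  -- This identity dictates the choice of `K`: the quadratic term uses exactly half of the available
  -- increment, and the other half absorbs `C * H`.
  have hKe : 2 * C * K ^ ((s - 2) / s) = K := by
    have : K ^ (2 / s) = 2 * C := by
      rw [hK, ← Real.rpow_mul (by linarith)]
      rw [show s / 2 * (2 / s) = 1 by field_simp, Real.rpow_one]
    rw [← this, ← Real.rpow_add hK0, show 2 / s + (s - 2) / s = 1 by field_simp; ring,
      Real.rpow_one]
  rcases Nat.eq_zero_or_pos n with rfl | hn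
  · have : a = 0 := by
      rw [Nat.cast_zero, Real.zero_rpow (by positivity)] at ha
      linarith
    subst this
    have h1 : (0 : ℝ) ^ ((s - 2) / s) ≤ 1 := Real.rpow_le_one le_rfl zero_le_one
      (div_nonneg (by linarith) hs0.le)
    -- For `s = 2` the exponent vanishes and `0 ^ 0 = 1`, so the quadratic term contributes even
    -- when `a = 0`.
    rcases hs.eq_or_lt with rfl | hs2
    · simp only [sub_self, zero_div, Real.rpow_zero, div_self (two_ne_zero' ℝ), Real.rpow_one]
      norm_num
      nlinarith
    · rw [Real.zero_rpow (div_pos (by linarith) hs0).ne']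
      simp only [zero_mul, zero_add, Nat.cast_one, Real.one_rpow, mul_one]
      nlinarith
  have hn1 : (1 : ℝ) ≤ n := by exact_mod_cast hn
  have hn0 : (0 : ℝ) < n := by linarith
  have he : 0 ≤ (s - 2) / s := div_nonneg (by linarith) hs0.le
  have h1 : a ^ ((s - 2) / s) * H ^ (2 / s) ≤ K ^ ((s - 2) / s) * (n : ℝ) ^ (s / 2 - 1) * H := by
    calc a ^ ((s - 2) / s) * H ^ (2 / s)
        ≤ (K * (n : ℝ) ^ (s / 2) * H) ^ ((s - 2) / s) * H ^ (2 / s) := by gcongr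
      _ = K ^ ((s - 2) / s) * (n : ℝ) ^ (s / 2 - 1) * H := by
          rw [Real.mul_rpow (by positivity) hH, Real.mul_rpow hK0.le (by positivity),
            ← Real.rpow_mul hn0.le, show s / 2 * ((s - 2) / s) = s / 2 - 1 by field_simp,
            mul_assoc _ _ (H ^ (2 / s)), ← Real.rpow_add' hH]
          · rw [show (s - 2) / s + 2 / s = 1 by field_simp; ring, Real.rpow_one]
          · rw [show (s - 2) / s + 2 / s = 1 by field_simp; ring]; norm_num
  have hpow : (1 : ℝ) ≤ (n : ℝ) ^ (s / 2 - 1) := Real.one_le_rpow hn1 (by linarith)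
  have h2 : (n : ℝ) ^ (s / 2) + (n : ℝ) ^ (s / 2 - 1) ≤ ((n + 1 : ℕ) : ℝ) ^ (s / 2) := by
    have hb := one_add_mul_self_le_rpow_one_add (s := 1 / (n : ℝ)) (p := s / 2)
      (by have : 0 ≤ 1 / (n : ℝ) := by positivity
          linarith) (by linarith)
    have e : ((n + 1 : ℕ) : ℝ) = n * (1 + 1 / n) := by push_cast; field_simp
    rw [e, Real.mul_rpow hn0.le (by positivity)]
    have e2 : (n : ℝ) ^ (s / 2 - 1) = (n : ℝ) ^ (s / 2) * (1 / n) := by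
      rw [Real.rpow_sub_one hn0.ne']; ring
    rw [e2]
    have : 1 + 1 / (n : ℝ) ≤ 1 + s / 2 * (1 / (n : ℝ)) := by
      have : 0 ≤ 1 / (n : ℝ) := by positivity
      nlinarith
    nlinarith [mul_le_mul_of_nonneg_left (this.trans hb) (Real.rpow_nonneg hn0.le (s / 2))]
  have hK2 : C * (K ^ ((s - 2) / s) * (n : ℝ) ^ (s / 2 - 1) + 1) ≤ K * (n : ℝ) ^ (s / 2 - 1) := by
    have e1 : C * (K ^ ((s - 2) / s) * (n : ℝ) ^ (s / 2 - 1)) = K / 2 * (n : ℝ) ^ (s / 2 - 1) := by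
      linear_combination (n : ℝ) ^ (s / 2 - 1) / 2 * hKe
    have e2 : C ≤ K / 2 * (n : ℝ) ^ (s / 2 - 1) := by nlinarith
    linarith
  calc a + C * (a ^ ((s - 2) / s) * H ^ (2 / s) + H)
      ≤ K * (n : ℝ) ^ (s / 2) * H + C * (K ^ ((s - 2) / s) * (n : ℝ) ^ (s / 2 - 1) * H + H) := by
        gcongr
    _ = K * (n : ℝ) ^ (s / 2) * H + C * (K ^ ((s - 2) / s) * (n : ℝ) ^ (s / 2 - 1) + 1) * H := by
        ring
    _ ≤ K * (n : ℝ) ^ (s / 2) * H + K * (n : ℝ) ^ (s / 2 - 1) * H := by gcongr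
    _ = K * ((n : ℝ) ^ (s / 2) + (n : ℝ) ^ (s / 2 - 1)) * H := by ring
    _ ≤ _ := by gcongr

/-- The constant of the Marcinkiewicz–Zygmund inequality below. -/
noncomputable def mzConst (s : ℝ) : ℝ := (2 * (s * (s - 1) * 2 ^ (s - 2))) ^ (s / 2)

/-- **Marcinkiewicz–Zygmund inequality** for sums of independent centred variables whose `s`-th
absolute moments are bounded by `H`. -/
theorem integral_abs_sum_rpow_le [IsProbabilityMeasure P] {ι : Type*} {Y : ι → Ω → ℝ}
    {s H : ℝ} (hs : 2 ≤ s) (hY : ∀ i, Measurable (Y i)) (hind : iIndepFun Y P)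
    (hint : ∀ i, Integrable (fun x => |Y i x| ^ s) P) (h0 : ∀ i, ∫ x, Y i x ∂P = 0)
    (hH : ∀ i, ∫ x, |Y i x| ^ s ∂P ≤ H) (hH0 : 0 ≤ H) (F : Finset ι) :
    Integrable (fun x => |∑ i ∈ F, Y i x| ^ s) P ∧
      ∫ x, |∑ i ∈ F, Y i x| ^ s ∂P ≤ mzConst s * (F.card : ℝ) ^ (s / 2) * H := by
  classical
  have hs0 : 0 < s := by linarith
  have hC : 1 ≤ s * (s - 1) * 2 ^ (s - 2) := by
    have h1 : (1 : ℝ) ≤ 2 ^ (s - 2) := Real.one_le_rpow (by norm_num) (by linarith)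
    have h2 : 2 ≤ s * (s - 1) := by nlinarith
    nlinarith
  induction F using Finset.induction_on with
  | empty =>
    simp only [Finset.sum_empty, abs_zero, Real.zero_rpow hs0.ne', integral_zero,
      Finset.card_empty, Nat.cast_zero, Real.zero_rpow (show s / 2 ≠ 0 by positivity), mul_zero,
      zero_mul, le_refl, and_true]
    exact integrable_zero _ _ _
  | insert i F hi IH =>
    obtain ⟨IH1, IH2⟩ := IH
    -- Expand `|S + Y i| ^ s` to second order: independence and centring kill the linear term, and
    -- independence with Jensen's inequality bounds the quadratic one by the moments of order `s`.
    set S : Ω → ℝ := fun x => ∑ j ∈ F, Y j x with hS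
    have mS : Measurable S := by fun_prop
    have mY := hY i
    have hindS : IndepFun S (Y i) P := by
      have := iIndepFun.indepFun_finsetSum_of_notMem hind hY hi
      convert this using 1
      ext x; simp [hS]
    have hsum : ∀ x, ∑ j ∈ insert i F, Y j x = S x + Y i x := fun x => by
      rw [Finset.sum_insert hi, add_comm]
    simp only [hsum]
    have iS2 : Integrable (fun x => |S x| ^ (s - 2)) P :=
      integrable_abs_rpow_of_le (by linarith) (by linarith) IH1
    have iS1 : Integrable (fun x => |S x| ^ (s - 2) * S x) P := by
      have := integrable_abs_rpow_of_le (a := s - 1) (by linarith) (by linarith) IH1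
      refine this.mono' (by fun_prop) (ae_of_all _ fun x => ?_)
      rw [norm_mul, Real.norm_of_nonneg (by positivity), Real.norm_eq_abs,
        ← Real.rpow_add_one' (abs_nonneg _) (by linarith)]
      exact le_of_eq (by congr 1; ring)
    have iY2' : Integrable (fun x => |Y i x| ^ (2 : ℝ)) P :=
      integrable_abs_rpow_of_le (by norm_num) hs (hint i)
    have iY2 : Integrable (fun x => Y i x ^ 2) P := by simpa [sq_abs] using iY2'
    have iY1 : Integrable (Y i) P := by
      have := integrable_abs_rpow_of_le (a := 1) (by norm_num) (by linarith) (hint i)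
      refine this.mono' (by fun_prop) (ae_of_all _ fun x => by simp)
    have ind1 : IndepFun (fun x => |S x| ^ (s - 2) * S x) (Y i) P :=
      hindS.comp (φ := fun t => |t| ^ (s - 2) * t) (ψ := id) (by fun_prop) measurable_id
    have ind2 : IndepFun (fun x => |S x| ^ (s - 2)) (fun x => Y i x ^ 2) P :=
      hindS.comp (φ := fun t => |t| ^ (s - 2)) (ψ := fun t => t ^ 2) (by fun_prop) (by fun_prop)
    have i1 : Integrable (fun x => |S x| ^ (s - 2) * S x * Y i x) P := ind1.integrable_mul iS1 iY1
    have i2 : Integrable (fun x => |S x| ^ (s - 2) * Y i x ^ 2) P := ind2.integrable_mul iS2 iY2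
    have hnew := integrable_abs_add_rpow mS mY hs0.le IH1 (hint i)
    refine ⟨hnew, ?_⟩
    set C := s * (s - 1) * 2 ^ (s - 2) with hCdef
    have e1 : ∫ x, |S x| ^ (s - 2) * S x * Y i x ∂P = 0 := by
      rw [ind1.integral_fun_mul_eq_mul_integral iS1.aestronglyMeasurable iY1.aestronglyMeasurable,
        h0, mul_zero]
    have e2 : ∫ x, |S x| ^ (s - 2) * Y i x ^ 2 ∂P
        ≤ (∫ x, |S x| ^ s ∂P) ^ ((s - 2) / s) * H ^ (2 / s) := by
      rw [ind2.integral_fun_mul_eq_mul_integral iS2.aestronglyMeasurable iY2.aestronglyMeasurable]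
      have hb : ∫ x, Y i x ^ 2 ∂P ≤ H ^ (2 / s) := by
        have := integral_abs_rpow_le (P := P) (g := Y i) (a := 2) (by norm_num) hs hs0 (hint i)
        simp only [Real.rpow_two, sq_abs] at this
        refine this.trans ?_
        exact Real.rpow_le_rpow (integral_nonneg fun x => by positivity) (hH i) (by positivity)
      exact mul_le_mul
        (integral_abs_rpow_le (P := P) (g := S) (by linarith) (by linarith) hs0 IH1) hb
        (integral_nonneg fun x => by positivity)
        (Real.rpow_nonneg (integral_nonneg fun x => by positivity) _)
    have j1 : Integrable (fun x => |S x| ^ s + s * (|S x| ^ (s - 2) * S x * Y i x)) P :=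
      IH1.add (i1.const_mul s)
    have j3 : Integrable (fun x => C * (|S x| ^ (s - 2) * Y i x ^ 2 + |Y i x| ^ s)) P :=
      (i2.add (hint i)).const_mul C
    have main : ∫ x, |S x + Y i x| ^ s ∂P ≤ ∫ x, (|S x| ^ s + s * (|S x| ^ (s - 2) * S x * Y i x)
        + C * (|S x| ^ (s - 2) * Y i x ^ 2 + |Y i x| ^ s)) ∂P := by
      refine integral_mono hnew (j1.add j3) fun x => ?_
      have := abs_add_rpow_le hs (S x) (Y i x)
      simp only [← mul_assoc] at this ⊢
      exact this
    rw [integral_add j1 j3, integral_add IH1 (i1.const_mul s), integral_const_mul, e1, mul_zero, add_zero,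
      integral_const_mul, integral_add i2 (hint i)] at main
    rw [Finset.card_insert_of_notMem hi]
    refine main.trans (le_trans ?_ (marcinkiewicz_zygmund_step hs hC rfl hH0
      (integral_nonneg fun x => by positivity) IH2))
    have := hH i
    gcongr

end Moments

/-! ### Pointwise control of the self-normalized error -/

section Pointwise

variable {X : Type*} {w f : X → ℝ} {N : ℕ}

lemma avgWeight_pos (hN : 1 ≤ N) {x : Fin N → X} (hx : ∀ n, 0 < w (x n)) : 0 < avgWeight w x := by
  have : Nonempty (Fin N) := ⟨⟨0, hN⟩⟩
  have : (0 : ℝ) < N := by exact_mod_cast hN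
  exact mul_pos (by positivity) (Finset.sum_pos (fun n _ => hx n) Finset.univ_nonempty)

/-- Multiplying by the average weight cancels the random denominator; for `c = π(f)` what remains is
an average of centred independent terms. -/
lemma avgWeight_mul_snis_sub (hN : 1 ≤ N) {x : Fin N → X} (hx : 0 < avgWeight w x) (c : ℝ) :
    avgWeight w x * (snis w f x - c) = (N : ℝ)⁻¹ * ∑ n, w (x n) * (f (x n) - c) := by
  have hN0 : (0 : ℝ) < N := by exact_mod_cast hN
  have hS : ∑ n, w (x n) ≠ 0 := by
    rintro h; simp [avgWeight, h] at hx
  unfold avgWeight snis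
  simp only [mul_sub, Finset.sum_sub_distrib, ← Finset.sum_mul]
  field_simp

/-- A self-normalized average deviates from `c` by no more than its worst term. -/
lemma abs_snis_sub_rpow_le (hN : 1 ≤ N) {x : Fin N → X} (hx : ∀ n, 0 < w (x n)) (c : ℝ) {r : ℝ}
    (hr : 0 ≤ r) : |snis w f x - c| ^ r ≤ ∑ n, |f (x n) - c| ^ r := by
  have : Nonempty (Fin N) := ⟨⟨0, hN⟩⟩
  obtain ⟨m, -, hm⟩ := Finset.exists_max_image Finset.univ (fun n => |f (x n) - c|)
    Finset.univ_nonempty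
  have hS : 0 < ∑ n, w (x n) := Finset.sum_pos (fun n _ => hx n) Finset.univ_nonempty
  have h1 : |snis w f x - c| ≤ |f (x m) - c| := by
    have e : snis w f x - c = (∑ n, w (x n) * (f (x n) - c)) / ∑ n, w (x n) := by
      unfold snis
      simp only [mul_sub, Finset.sum_sub_distrib, ← Finset.sum_mul]
      field_simp
    rw [e, abs_div, abs_of_pos hS, div_le_iff₀ hS, Finset.mul_sum]
    refine (Finset.abs_sum_le_sum_abs _ _).trans (Finset.sum_le_sum fun n _ => ?_)
    rw [abs_mul, abs_of_pos (hx n), mul_comm]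
    exact mul_le_mul_of_nonneg_right (hm n (Finset.mem_univ n)) (hx n).le
  exact (Real.rpow_le_rpow (abs_nonneg _) h1 hr).trans
    (Finset.single_le_sum (f := fun n => |f (x n) - c| ^ r) (fun n _ => by positivity)
      (Finset.mem_univ m))

/-- Three regimes, one per term on the right. If the average weight is at least `1/2`, dividing by
it costs a factor `2`. If it is smaller, then `2 |Ẑ - 1| ≥ 1` pays for an error of size at most `L`.
An error above `L` is traded for its `r`-th power, which the worst term dominates. -/
lemma abs_snis_sub_rpow_le_add (hN : 1 ≤ N) {x : Fin N → X} (hx : ∀ n, 0 < w (x n)) (c : ℝ)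
    {s p r L : ℝ} (hs : 0 < s) (hp : 0 < p) (hr : s ≤ r) (hL : 0 < L) :
    |snis w f x - c| ^ s + |avgWeight w x * (snis w f x - c)| ^ s ≤
      (2 ^ s + 1) * |(N : ℝ)⁻¹ * ∑ n, w (x n) * (f (x n) - c)| ^ s
        + L ^ s * 2 ^ p * |avgWeight w x - 1| ^ p + L ^ (s - r) * ∑ n, |f (x n) - c| ^ r := by
  have hA := avgWeight_pos hN hx
  rw [← avgWeight_mul_snis_sub hN hA c]
  set a := snis w f x - c
  set A := avgWeight w x
  have h1 : |a| ^ s ≤ 2 ^ s * |A * a| ^ s + L ^ s * 2 ^ p * |A - 1| ^ p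
      + L ^ (s - r) * ∑ n, |f (x n) - c| ^ r := by
    have hsum := abs_snis_sub_rpow_le (f := f) hN hx c (r := r) (by linarith)
    have n1 : 0 ≤ 2 ^ s * |A * a| ^ s := by positivity
    have n2 : 0 ≤ L ^ s * 2 ^ p * |A - 1| ^ p := by positivity
    have n3 : 0 ≤ L ^ (s - r) * ∑ n, |f (x n) - c| ^ r := by positivity
    rcases le_or_gt (1 / 2) A with h | h
    · have : |a| ^ s ≤ 2 ^ s * |A * a| ^ s := by
        rw [← Real.mul_rpow (by norm_num) (abs_nonneg _)]
        apply Real.rpow_le_rpow (abs_nonneg _) _ hs.le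
        rw [abs_mul, abs_of_pos hA]
        nlinarith [abs_nonneg a]
      linarith
    · rcases le_or_gt |a| L with h' | h'
      · have e1 : |a| ^ s ≤ L ^ s := Real.rpow_le_rpow (abs_nonneg _) h' hs.le
        have e2 : 1 ≤ 2 ^ p * |A - 1| ^ p := by
          rw [← Real.mul_rpow (by norm_num) (abs_nonneg _)]
          apply Real.one_le_rpow _ hp.le
          rw [abs_of_neg (by linarith)]; linarith
        have : L ^ s ≤ L ^ s * 2 ^ p * |A - 1| ^ p := by
          rw [mul_assoc]; exact le_mul_of_one_le_right (by positivity) e2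
        linarith
      · have ha : 0 < |a| := hL.trans h'
        have : |a| ^ s ≤ L ^ (s - r) * |a| ^ r := by
          calc |a| ^ s = |a| ^ (s - r) * |a| ^ r := by rw [← Real.rpow_add ha]; congr 1; ring
            _ ≤ _ := by
              gcongr ?_ * _
              exact Real.rpow_le_rpow_of_nonpos hL h'.le (by linarith)
        have := this.trans (mul_le_mul_of_nonneg_left hsum (by positivity))
        linarith
  linarith

end Pointwise

/-! ### Moments of the self-normalized error under the particle law -/

section Estimator

variable {X : Type*} [MeasurableSpace X] {q : Measure X} {w f : X → ℝ} {N : ℕ}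

lemma measurable_avgWeight (hw : Measurable w) :
    Measurable (avgWeight w : (Fin N → X) → ℝ) := by
  unfold avgWeight; fun_prop

lemma measurable_snis (hw : Measurable w) (hf : Measurable f) :
    Measurable (snis w f : (Fin N → X) → ℝ) := by
  unfold snis; fun_prop

/-- The `s`-th moment of an average of `N` centred independent copies is of order `N ^ (-s / 2)`. -/
lemma integral_abs_average_rpow_le [IsProbabilityMeasure q] {g : X → ℝ} {s : ℝ} (hs : 2 ≤ s)
    (hg : Measurable g) (ig : Integrable (fun x => |g x| ^ s) q) (h0 : ∫ x, g x ∂q = 0)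
    (hN : 1 ≤ N) :
    Integrable (fun x : Fin N → X => |(N : ℝ)⁻¹ * ∑ n, g (x n)| ^ s) (Measure.pi fun _ => q) ∧
      ∫ x : Fin N → X, |(N : ℝ)⁻¹ * ∑ n, g (x n)| ^ s ∂(Measure.pi fun _ => q)
        ≤ mzConst s * (∫ x, |g x| ^ s ∂q) * (N : ℝ) ^ (-s / 2) := by
  have mp : ∀ n : Fin N, MeasurePreserving (Function.eval n)
      (Measure.pi fun _ : Fin N => q) q := fun n => measurePreserving_eval _ n
  have hN0 : (0 : ℝ) < N := by exact_mod_cast hN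
  have key := integral_abs_sum_rpow_le (P := Measure.pi fun _ : Fin N => q)
    (Y := fun n x => g (x n)) (H := ∫ x, |g x| ^ s ∂q) hs (fun n => by fun_prop)
    (iIndepFun_pi (X := fun _ => g) fun _ => hg.aemeasurable)
    (fun n => (mp n).integrable_comp_of_integrable ig)
    (fun n => (integral_comp_eval (i := n) hg.aestronglyMeasurable).trans h0)
    (fun n => (integral_comp_eval (X := fun _ => X) (μ := fun _ => q) (i := n)
      (f := fun y => |g y| ^ s) ig.aestronglyMeasurable).le)
    (integral_nonneg fun x => by positivity) Finset.univ
  have e : ∀ x : Fin N → X, |(N : ℝ)⁻¹ * ∑ n, g (x n)| ^ s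
      = (N : ℝ) ^ (-s) * |∑ n, g (x n)| ^ s := fun x => by
    rw [abs_mul, Real.mul_rpow (abs_nonneg _) (abs_nonneg _), abs_of_pos (by positivity),
      Real.inv_rpow hN0.le, Real.rpow_neg hN0.le]
  simp only [e]
  refine ⟨key.1.const_mul _, ?_⟩
  rw [integral_const_mul]
  refine (mul_le_mul_of_nonneg_left key.2 (by positivity)).trans (le_of_eq ?_)
  rw [Finset.card_univ, Fintype.card_fin, show -s / 2 = -s + s / 2 by ring, Real.rpow_add hN0]
  ring

lemma ae_avgWeight_pos [IsProbabilityMeasure q] (hN : 1 ≤ N) (hw : ∀ᵐ x ∂q, 0 < w x) :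
    ∀ᵐ x ∂(Measure.pi fun _ : Fin N => q), (∀ n, 0 < w (x n)) ∧ 0 < avgWeight w x := by
  have : ∀ᵐ x ∂(Measure.pi fun _ : Fin N => q), ∀ n, 0 < w (x n) :=
    ae_all_iff.2 fun n => (measurePreserving_eval (fun _ : Fin N => q) n).quasiMeasurePreserving.ae hw
  exact this.mono fun x hx => ⟨hx, avgWeight_pos hN hx⟩

/-- The constant of `integral_abs_snis_sub_rpow_le`. -/
noncomputable def momentConst (s p r Aw Af Ah : ℝ) : ℝ :=
  (2 ^ s + 1) * (mzConst s * (2 ^ s * (Ah + (1 + Ah) ^ s * (1 + Aw))))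
    + 2 ^ p * (mzConst p * (2 ^ p * (Aw + 1))) + 2 ^ r * (Af + (1 + Ah) ^ r)

lemma mzConst_nonneg {s : ℝ} (hs : 2 ≤ s) : 0 ≤ mzConst s := by
  unfold mzConst
  have : 0 ≤ s * (s - 1) := mul_nonneg (by linarith) (by linarith)
  positivity

lemma integral_abs_sub_const_rpow_le [IsProbabilityMeasure q] {g : X → ℝ} (hg : Measurable g)
    {a : ℝ} (ha : 0 ≤ a) (ig : Integrable (fun x => |g x| ^ a) q) (c : ℝ) :
    Integrable (fun x => |g x - c| ^ a) q ∧
      ∫ x, |g x - c| ^ a ∂q ≤ 2 ^ a * (∫ x, |g x| ^ a ∂q + |c| ^ a) := by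
  have i1 : Integrable (fun x => |g x - c| ^ a) q := by
    simpa [sub_eq_add_neg] using integrable_abs_add_rpow hg (measurable_const (a := -c)) ha ig
      (integrable_const _)
  refine ⟨i1, ?_⟩
  have : ∫ x, |g x - c| ^ a ∂q ≤ ∫ x, 2 ^ a * (|g x| ^ a + |c| ^ a) ∂q := by
    refine integral_mono i1 ((ig.add (integrable_const _)).const_mul _) fun x => ?_
    refine le_trans ?_ (add_rpow_le_two_rpow_mul ha (abs_nonneg _) (abs_nonneg _))
    exact Real.rpow_le_rpow (abs_nonneg _) (abs_sub _ _) ha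
  rwa [integral_const_mul, integral_add ig (integrable_const _), integral_const, probReal_univ,
    one_smul] at this

/-- Moments of the error of the self-normalized importance sampling estimator, under the law of
the particles and under the law tilted by a power of the average weight. -/
theorem integral_abs_snis_sub_rpow_le [IsProbabilityMeasure q] {s p r Aw Af Ah : ℝ} (hs : 2 ≤ s)
    (hsp : s < p) (hsr : s < r) (hspr : s * (p + r + 2) ≤ p * r) (hw : Measurable w)
    (hf : Measurable f) (hw0 : ∀ᵐ x ∂q, 0 < w x) (hw1 : ∫ x, w x ∂q = 1)
    (iw : Integrable (fun x => |w x| ^ p) q) (jf : Integrable (fun x => |f x| ^ r) q)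
    (ih : Integrable (fun x => |w x * f x| ^ s) q) (bw : ∫ x, |w x| ^ p ∂q ≤ Aw)
    (bf : ∫ x, |f x| ^ r ∂q ≤ Af) (bh : ∫ x, |w x * f x| ^ s ∂q ≤ Ah) (hN : 1 ≤ N) :
    Integrable (fun x => |snis w f x - ∫ x, w x * f x ∂q| ^ s
        + |avgWeight w x * (snis w f x - ∫ x, w x * f x ∂q)| ^ s) (Measure.pi fun _ : Fin N => q) ∧
      ∫ x, (|snis w f x - ∫ x, w x * f x ∂q| ^ s
        + |avgWeight w x * (snis w f x - ∫ x, w x * f x ∂q)| ^ s) ∂(Measure.pi fun _ : Fin N => q)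
        ≤ momentConst s p r Aw Af Ah * (N : ℝ) ^ (-s / 2) := by
  set c := ∫ x, w x * f x ∂q with hc
  have hs0 : 0 < s := by linarith
  have hN0 : (0 : ℝ) < N := by exact_mod_cast hN
  have hN1 : (1 : ℝ) ≤ N := by exact_mod_cast hN
  have hAh : 0 ≤ Ah := le_trans (integral_nonneg fun x => by positivity) bh
  have hAw : 0 ≤ Aw := le_trans (integral_nonneg fun x => by positivity) bw
  have hAf : 0 ≤ Af := le_trans (integral_nonneg fun x => by positivity) bf
  have iws := integrable_abs_rpow_of_le hs0.le hsp.le iw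
  have iw1 : Integrable w q := by
    have := integrable_abs_rpow_of_le zero_le_one (by linarith) iw
    exact this.mono' hw.aestronglyMeasurable (ae_of_all _ fun x => by simp)
  have ih1' := integrable_abs_rpow_of_le zero_le_one (by linarith) ih
  have ih1 : Integrable (fun x => w x * f x) q :=
    ih1'.mono' (hw.mul hf).aestronglyMeasurable (ae_of_all _ fun x => by simp)
  have bws : ∫ x, |w x| ^ s ∂q ≤ 1 + Aw := by
    have : ∫ x, |w x| ^ s ∂q ≤ ∫ x, (1 + |w x| ^ p) ∂q :=
      integral_mono iws ((integrable_const _).add iw) fun x =>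
        rpow_le_one_add_rpow (abs_nonneg _) hs0.le hsp.le
    rw [integral_add (integrable_const _) iw, integral_const, probReal_univ, one_smul] at this
    linarith
  have bc : |c| ≤ 1 + Ah := by
    have h1 : |c| ≤ ∫ x, |w x * f x| ∂q := abs_integral_le_integral_abs
    have h2 : ∫ x, |w x * f x| ∂q ≤ ∫ x, (1 + |w x * f x| ^ s) ∂q :=
      integral_mono ih1.abs ((integrable_const _).add ih) fun x => by
        simpa using rpow_le_one_add_rpow (abs_nonneg (w x * f x)) zero_le_one (b := s) (by linarith)
    rw [integral_add (integrable_const _) ih, integral_const, probReal_univ, one_smul] at h2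
    linarith
  -- the centred numerator
  have mg : Measurable fun x => w x * (f x - c) := by fun_prop
  have hdom : ∀ x, |w x * (f x - c)| ^ s ≤ 2 ^ s * (|w x * f x| ^ s + |c| ^ s * |w x| ^ s) := by
    intro x
    rw [← Real.mul_rpow (abs_nonneg _) (abs_nonneg _), ← abs_mul]
    refine le_trans ?_ (add_rpow_le_two_rpow_mul hs0.le (abs_nonneg _) (abs_nonneg _))
    refine Real.rpow_le_rpow (abs_nonneg _) ?_ hs0.le
    rw [mul_sub, mul_comm c]
    exact abs_sub _ _
  have ig : Integrable (fun x => |w x * (f x - c)| ^ s) q :=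
    ((ih.add (iws.const_mul _)).const_mul (2 ^ s)).mono' (mg.abs.pow_const s).aestronglyMeasurable (ae_of_all _ fun x => by
      rw [Real.norm_of_nonneg (by positivity)]; exact hdom x)
  have bg : ∫ x, |w x * (f x - c)| ^ s ∂q ≤ 2 ^ s * (Ah + (1 + Ah) ^ s * (1 + Aw)) := by
    have : ∫ x, |w x * (f x - c)| ^ s ∂q
        ≤ ∫ x, 2 ^ s * (|w x * f x| ^ s + |c| ^ s * |w x| ^ s) ∂q :=
      integral_mono ig ((ih.add (iws.const_mul _)).const_mul (2 ^ s)) hdom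
    rw [integral_const_mul, integral_add ih (iws.const_mul _), integral_const_mul] at this
    refine this.trans ?_
    have := integral_nonneg (μ := q) (f := fun x => |w x| ^ s) fun x => by positivity
    gcongr
  have g0 : ∫ x, w x * (f x - c) ∂q = 0 := by
    simp only [mul_sub]
    rw [integral_sub ih1 (iw1.mul_const c), integral_mul_const, hw1, ← hc]; ring
  obtain ⟨I1, B1⟩ := integral_abs_average_rpow_le hs mg ig g0 hN
  -- the average weight
  obtain ⟨iw', bw'⟩ := integral_abs_sub_const_rpow_le hw (a := p) (by linarith) iw 1
  rw [abs_one, Real.one_rpow] at bw'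
  have w0 : ∫ x, (w x - 1) ∂q = 0 := by
    rw [integral_sub iw1 (integrable_const _), hw1]; simp
  obtain ⟨I2, B2⟩ := integral_abs_average_rpow_le (by linarith) (hw.sub_const 1) iw' w0 hN
  have eA : ∀ x : Fin N → X, (N : ℝ)⁻¹ * ∑ n, (w (x n) - 1) = avgWeight w x - 1 := fun x => by
    simp only [avgWeight, Finset.sum_sub_distrib, Finset.sum_const, Finset.card_univ,
      Fintype.card_fin, nsmul_eq_mul, mul_one, mul_sub]
    rw [inv_mul_cancel₀ hN0.ne']
  simp only [eA] at I2 B2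
  -- the worst term
  obtain ⟨iff', bff'⟩ := integral_abs_sub_const_rpow_le hf (a := r) (by linarith) jf c
  have mp : ∀ n : Fin N, MeasurePreserving (Function.eval n)
      (Measure.pi fun _ : Fin N => q) q := fun n => measurePreserving_eval _ n
  have I3' : ∀ n, Integrable (fun x : Fin N → X => |f (x n) - c| ^ r) (Measure.pi fun _ => q) :=
    fun n => (mp n).integrable_comp_of_integrable iff'
  have I3 : Integrable (fun x : Fin N → X => ∑ n, |f (x n) - c| ^ r) (Measure.pi fun _ => q) :=
    integrable_finsetSum _ fun n _ => I3' n
  have B3 : ∫ x : Fin N → X, ∑ n, |f (x n) - c| ^ r ∂(Measure.pi fun _ => q)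
      ≤ N * (2 ^ r * (Af + (1 + Ah) ^ r)) := by
    rw [integral_finsetSum _ fun n _ => I3' n]
    have : ∀ n : Fin N, ∫ x : Fin N → X, |f (x n) - c| ^ r ∂(Measure.pi fun _ => q)
        ≤ 2 ^ r * (Af + (1 + Ah) ^ r) := fun n => by
      rw [integral_comp_eval (X := fun _ => X) (μ := fun _ => q) (i := n)
        (f := fun y => |f y - c| ^ r) iff'.aestronglyMeasurable]
      refine bff'.trans ?_
      have : 0 ≤ r := by linarith
      gcongr
    refine (Finset.sum_le_sum fun n _ => this n).trans (le_of_eq ?_)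
    simp
  -- This level gives `L ^ s * N ^ (-p / 2) = N ^ (-s / 2)`, the largest truncation that the
  -- fluctuations of the average weight allow. The other requirement, `L ^ (s - r) * N ≤ N ^ (-s /
  -- 2)`, then amounts to `hspr`.
  set L : ℝ := (N : ℝ) ^ ((p - s) / (2 * s)) with hL
  have hL0 : 0 < L := by positivity
  have J12 : Integrable (fun x : Fin N → X =>
      (2 ^ s + 1) * |(N : ℝ)⁻¹ * ∑ n, w (x n) * (f (x n) - c)| ^ s
        + L ^ s * 2 ^ p * |avgWeight w x - 1| ^ p) (Measure.pi fun _ => q) :=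
    (I1.const_mul _).add (I2.const_mul _)
  have IR : Integrable (fun x : Fin N → X =>
      (2 ^ s + 1) * |(N : ℝ)⁻¹ * ∑ n, w (x n) * (f (x n) - c)| ^ s
        + L ^ s * 2 ^ p * |avgWeight w x - 1| ^ p + L ^ (s - r) * ∑ n, |f (x n) - c| ^ r)
      (Measure.pi fun _ => q) :=
    J12.add (I3.const_mul _)
  have hle : ∀ᵐ x ∂(Measure.pi fun _ : Fin N => q),
      |snis w f x - c| ^ s + |avgWeight w x * (snis w f x - c)| ^ s ≤
      (2 ^ s + 1) * |(N : ℝ)⁻¹ * ∑ n, w (x n) * (f (x n) - c)| ^ s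
        + L ^ s * 2 ^ p * |avgWeight w x - 1| ^ p + L ^ (s - r) * ∑ n, |f (x n) - c| ^ r :=
    (ae_avgWeight_pos hN hw0).mono fun x hx =>
      abs_snis_sub_rpow_le_add hN hx.1 c hs0 (by linarith) hsr.le hL0
  have mA := measurable_avgWeight (N := N) hw
  have mS := measurable_snis (N := N) hw hf
  have IL : Integrable (fun x => |snis w f x - c| ^ s
      + |avgWeight w x * (snis w f x - c)| ^ s) (Measure.pi fun _ : Fin N => q) :=
    IR.mono' (by fun_prop) (hle.mono fun x hx => by
      rwa [Real.norm_of_nonneg (by positivity)])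
  refine ⟨IL, (integral_mono_ae IL IR hle).trans ?_⟩
  rw [integral_add J12 (I3.const_mul _),
    integral_add (I1.const_mul _) (I2.const_mul _), integral_const_mul, integral_const_mul,
    integral_const_mul]
  have hm1 := mzConst_nonneg hs
  have hm2 := mzConst_nonneg (s := p) (by linarith)
  have hLs : L ^ s * (N : ℝ) ^ (-p / 2) = (N : ℝ) ^ (-s / 2) := by
    rw [hL, ← Real.rpow_mul hN0.le, ← Real.rpow_add hN0]
    congr 1; field_simp; ring
  have hLr : L ^ (s - r) * N ≤ (N : ℝ) ^ (-s / 2) := by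
    rw [hL, ← Real.rpow_mul hN0.le, ← Real.rpow_add_one hN0.ne']
    apply Real.rpow_le_rpow_of_exponent_le hN1
    rw [div_mul_eq_mul_div, div_add_one (by positivity), div_le_div_iff₀ (by positivity) (by norm_num)]
    nlinarith
  have T1 : (2 ^ s + 1) * ∫ x : Fin N → X, |(N : ℝ)⁻¹ * ∑ n, w (x n) * (f (x n) - c)| ^ s
      ∂(Measure.pi fun _ => q) ≤ (2 ^ s + 1) * (mzConst s * (2 ^ s * (Ah + (1 + Ah) ^ s * (1 + Aw)))
        * (N : ℝ) ^ (-s / 2)) := by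
    gcongr
    exact B1.trans (by gcongr)
  have T2 : L ^ s * 2 ^ p * ∫ x : Fin N → X, |avgWeight w x - 1| ^ p ∂(Measure.pi fun _ => q)
      ≤ 2 ^ p * (mzConst p * (2 ^ p * (Aw + 1))) * (N : ℝ) ^ (-s / 2) := by
    calc _ ≤ L ^ s * 2 ^ p * (mzConst p * (2 ^ p * (Aw + 1)) * (N : ℝ) ^ (-p / 2)) := by
          gcongr
          refine B2.trans ?_
          gcongr
          exact bw'.trans (by gcongr)
      _ = 2 ^ p * (mzConst p * (2 ^ p * (Aw + 1))) * (L ^ s * (N : ℝ) ^ (-p / 2)) := by ring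
      _ = _ := by rw [hLs]
  have T3 : L ^ (s - r) * ∫ x : Fin N → X, ∑ n, |f (x n) - c| ^ r ∂(Measure.pi fun _ => q)
      ≤ 2 ^ r * (Af + (1 + Ah) ^ r) * (N : ℝ) ^ (-s / 2) := by
    calc _ ≤ L ^ (s - r) * (N * (2 ^ r * (Af + (1 + Ah) ^ r))) := by gcongr
      _ = 2 ^ r * (Af + (1 + Ah) ^ r) * (L ^ (s - r) * N) := by ring
      _ ≤ _ := by gcongr
  calc _ ≤ _ := add_le_add (add_le_add T1 T2) T3
    _ = _ := by unfold momentConst; ring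

end Estimator

/-! ### Sample paths -/

/-- The acceptance ratios `b i / a` stay below the uniform draws `u i` for `i < k`. -/
def Waits (a : ℝ) (b u : ℕ → ℝ) (k : ℕ) : Prop := ∀ i < k, b i / a ≤ u i

open Classical in
/-- The number of steps a chain spends at a state of weight `a` when the proposals have weights
`b i` and the uniform draws are `u i`. -/
noncomputable def sojourn (a : ℝ) (b u : ℕ → ℝ) : ℝ≥0∞ := ∑' k, if Waits a b u k then 1 else 0

lemma Waits.mono {a : ℝ} {b u : ℕ → ℝ} {k l : ℕ} (h : Waits a b u l) (hkl : k ≤ l) :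
    Waits a b u k := fun i hi => h i (hi.trans_le hkl)

section Paths

variable {X : Type*} {N : ℕ} {w f : X → ℝ} {z : ℕ → Fin N → X} {u : ℕ → ℝ}

lemma laggedPair_eq_of_le {k l : ℕ} (hkl : k ≤ l)
    (h : (laggedPair w z u k).1 = (laggedPair w z u k).2) :
    (laggedPair w z u l).1 = (laggedPair w z u l).2 := by
  induction l, hkl using Nat.le_induction with
  | base => exact h
  | succ l _ ih => simp only [laggedPair, coupledStep, ih]

/-- Index `k` of `laggedPair` holds `(x_{k+1}, y_k)`, so the first index at which the components
agree is `τ - 1`. -/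
lemma exists_meetingTime_eq {T : ℕ} (h : (laggedPair w z u T).1 = (laggedPair w z u T).2) :
    ∃ m ≤ T, (laggedPair w z u m).1 = (laggedPair w z u m).2 ∧
      meetingTime w z u = ((m + 1 : ℕ) : ℕ∞) := by
  classical
  have hex : ∃ k, (laggedPair w z u k).1 = (laggedPair w z u k).2 := ⟨T, h⟩
  refine ⟨Nat.find hex, Nat.find_le h, Nat.find_spec hex, le_antisymm ?_ ?_⟩
  · exact iInf₂_le (Nat.find hex + 1) ⟨by omega, Nat.find_spec hex⟩
  · refine le_iInf₂ fun t ht => ?_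
    obtain ⟨k, rfl⟩ : ∃ k, t = k + 1 := ⟨t - 1, by omega⟩
    have := Nat.find_min' hex (m := k) ht.2
    exact_mod_cast Nat.succ_le_succ this

lemma meetingTime_lt_top {T : ℕ} (h : (laggedPair w z u T).1 = (laggedPair w z u T).2) :
    meetingTime w z u < ⊤ := by
  obtain ⟨m, -, -, hm⟩ := exists_meetingTime_eq h
  rw [hm]; exact ENat.natCast_lt_top _

/-- Once the chains have met, the estimator is the telescoping sum cut at any later time. -/
lemma uis_eq_sum_range {T n : ℕ} (h : (laggedPair w z u T).1 = (laggedPair w z u T).2)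
    (hn : T ≤ n) :
    uis w f z u = snis w f (z 0) + ∑ k ∈ Finset.range n,
      (snis w f (laggedPair w z u k).1 - snis w f (laggedPair w z u k).2) := by
  obtain ⟨m, hmT, hm, hτ⟩ := exists_meetingTime_eq h
  have : uis w f z u = snis w f (z 0) + ∑ k ∈ Finset.range m,
      (snis w f (laggedPair w z u k).1 - snis w f (laggedPair w z u k).2) := by
    unfold uis
    rw [hτ, ENat.toNat_natCast, Finset.sum_Ico_eq_sum_range]
    congr 1
    refine Finset.sum_congr (by simp) fun k _ => ?_
    rw [add_comm 1 k]
    rfl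
  rw [this]
  congr 1
  refine Finset.sum_subset (by simpa using hmT.trans hn) fun k _ hk => ?_
  rw [laggedPair_eq_of_le (by simpa using hk) hm, sub_self]

lemma pimhStep_of_le {x x' : Fin N → X} {v : ℝ} (h : avgWeight w x' / avgWeight w x ≤ v) :
    pimhStep w x x' v = x := if_neg h.not_gt

lemma pimhStep_of_lt {x x' : Fin N → X} {v : ℝ} (h : v < avgWeight w x' / avgWeight w x) :
    pimhStep w x x' v = x' := if_pos h

/-- As long as the leading chain rejects, it dominates the lagging one. -/
lemma laggedPair_of_waits (hA : ∀ t, 0 < avgWeight w (z t)) (hu : ∀ t, u t < 1) (k : ℕ)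
    (h : Waits (avgWeight w (z 0)) (fun i => avgWeight w (z (i + 1))) u (k + 1)) :
    (laggedPair w z u k).1 = z 0 ∧ 0 < avgWeight w (laggedPair w z u k).2 ∧
      avgWeight w (laggedPair w z u k).2 ≤ avgWeight w (z 0) := by
  -- The uniforms are below one, so only a proposal lighter than the current state can be rejected.
  have hlt : ∀ i < k + 1, avgWeight w (z (i + 1)) ≤ avgWeight w (z 0) := fun i hi => by
    have := (h i hi).trans (hu i).le
    rwa [div_le_one (hA 0)] at this
  induction k with
  | zero => exact ⟨pimhStep_of_le (h 0 (by omega)), hA 1, hlt 0 (by omega)⟩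
  | succ k ih =>
    obtain ⟨h1, h2, h3⟩ := ih (h.mono (by omega)) fun i hi => hlt i (by omega)
    simp only [laggedPair, coupledStep, h1]
    refine ⟨pimhStep_of_le (h (k + 1) (by omega)), ?_⟩
    unfold pimhStep
    split_ifs
    · exact ⟨hA _, hlt (k + 1) (by omega)⟩
    · exact ⟨h2, h3⟩

/-- The lagging state is no heavier than `z 0`, so its acceptance ratio is at least that of the
leading chain: the first proposal accepted by the latter is accepted by both. For `T = 0` the
accepted proposal is `y₀` itself. -/
lemma laggedPair_meet (hA : ∀ t, 0 < avgWeight w (z t)) (hu : ∀ t, u t < 1) {T : ℕ} (hu0 : 0 < u T)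
    (h : Waits (avgWeight w (z 0)) (fun i => avgWeight w (z (i + 1))) u T)
    (hT : ¬ avgWeight w (z (T + 1)) / avgWeight w (z 0) ≤ u T) :
    (laggedPair w z u T).1 = (laggedPair w z u T).2 := by
  cases T with
  | zero => exact pimhStep_of_lt (not_le.1 hT)
  | succ k =>
    obtain ⟨h1, h2, h3⟩ := laggedPair_of_waits hA hu k h
    simp only [laggedPair, coupledStep, h1]
    have hT' := not_le.1 hT
    rw [pimhStep_of_lt hT', pimhStep_of_lt (hT'.trans_le ?_)]
    exact div_le_div_of_nonneg_left (hA _).le h2 h3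

/-- The lagging chain sits at the last proposal it accepted. -/
lemma exists_laggedPair_snd_eq (k : ℕ) : ∃ j ≤ k, (laggedPair w z u k).2 = z (j + 1) ∧
    Waits (avgWeight w (z (j + 1))) (fun i => avgWeight w (z (j + 1 + i + 1)))
      (fun i => u (j + 1 + i)) (k - j) := by
  induction k with
  | zero => exact ⟨0, le_rfl, rfl, fun i hi => absurd hi (by simp)⟩
  | succ k ih =>
    obtain ⟨j, hj, h1, h2⟩ := ih
    simp only [laggedPair, coupledStep, h1]
    by_cases hc : u (k + 1) < avgWeight w (z (k + 2)) / avgWeight w (z (j + 1))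
    · exact ⟨k + 1, le_rfl, pimhStep_of_lt hc, fun i hi => absurd hi (by simp)⟩
    · refine ⟨j, by omega, pimhStep_of_le (not_lt.1 hc), fun i hi => ?_⟩
      rcases Nat.lt_or_ge i (k - j) with h | h
      · exact h2 i h
      · obtain rfl : i = k - j := by omega
        have e : j + 1 + (k - j) = k + 1 := by omega
        simp only [e]
        exact not_lt.1 hc

open Classical in
lemma natCast_le_sojourn {a : ℝ} {b u : ℕ → ℝ} {T : ℕ} (h : Waits a b u T) :
    ((T + 1 : ℕ) : ℝ≥0∞) ≤ sojourn a b u := by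
  refine le_trans ?_ (ENNReal.sum_le_tsum (Finset.range (T + 1)))
  rw [Finset.sum_congr rfl fun k hk => if_pos (h.mono (by simpa [Nat.lt_succ_iff] using hk))]
  simp

-- Each time `k` is charged to the step `j ≤ k` at which the lagging chain accepted its current
-- state. Whether `z (j + 1)` really was accepted is then forgotten: this only enlarges the sum, and
-- it leaves a sojourn that shares no draw with the waiting event before it.
open Classical in
lemma sum_enorm_laggedPair_snd_le {G : (Fin N → X) → ℝ} {a : ℝ} {b : ℕ → ℝ} {T : ℕ}
    (h : Waits a b u T) :
    ∑ k ∈ Finset.range T, ‖G (laggedPair w z u k).2‖ₑ ≤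
      ∑' j, (if Waits a b u j then 1 else 0) * (‖G (z (j + 1))‖ₑ *
        sojourn (avgWeight w (z (j + 1))) (fun i => avgWeight w (z (j + 1 + i + 1)))
          (fun i => u (j + 1 + i))) := by
  set D : ℕ → ℕ → Prop := fun j m => Waits (avgWeight w (z (j + 1)))
    (fun i => avgWeight w (z (j + 1 + i + 1))) (fun i => u (j + 1 + i)) m with hD
  set F : ℕ → ℕ → ℝ≥0∞ := fun j k =>
    if j ≤ k ∧ Waits a b u j ∧ D j (k - j) then ‖G (z (j + 1))‖ₑ else 0 with hF
  have h1 : ∀ k ∈ Finset.range T, ‖G (laggedPair w z u k).2‖ₑ ≤ ∑' j, F j k := by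
    intro k hk
    obtain ⟨j, hj, e, hw⟩ := exists_laggedPair_snd_eq (w := w) (z := z) (u := u) k
    refine le_trans (le_of_eq ?_) (ENNReal.le_tsum j)
    rw [hF]
    simp only
    rw [if_pos ⟨hj, h.mono (hj.trans (Finset.mem_range.1 hk).le), hw⟩, e]
  refine (Finset.sum_le_sum h1).trans ((ENNReal.sum_le_tsum _).trans ?_)
  rw [ENNReal.tsum_comm]
  refine ENNReal.tsum_le_tsum fun j => ?_
  have h2 : ∑' k, F j k = ∑' m, F j (m + j) := by
    rw [← ENNReal.summable.sum_add_tsum_nat_add' (f := F j) (k := j), Finset.sum_eq_zero, zero_add]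
    intro k hk
    exact if_neg fun hh => absurd hh.1 (by simpa using hk)
  rw [h2]
  unfold sojourn
  rw [← ENNReal.tsum_mul_left, ← ENNReal.tsum_mul_left]
  refine ENNReal.tsum_le_tsum fun m => ?_
  simp only [hF, Nat.add_sub_cancel, Nat.le_add_left, true_and]
  by_cases c1 : Waits a b u j <;> by_cases c2 : D j m <;> simp [c1, c2]
  exact (if_pos c2).ge

open Classical in
/-- The error of the estimator is bounded by the contribution of the leading chain, which stays at
its starting point until the meeting, and of the sojourns of the lagging chain. -/
lemma enorm_uis_sub_le (hA : ∀ t, 0 < avgWeight w (z t)) (hu0 : ∀ t, 0 < u t) (hu : ∀ t, u t < 1)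
    (hT : ∃ T, ¬ Waits (avgWeight w (z 0)) (fun i => avgWeight w (z (i + 1))) u T) (c : ℝ) :
    (∃ T, (laggedPair w z u T).1 = (laggedPair w z u T).2) ∧
    ‖uis w f z u - c‖ₑ ≤ ‖snis w f (z 0) - c‖ₑ *
        sojourn (avgWeight w (z 0)) (fun i => avgWeight w (z (i + 1))) u +
      ∑' j, (if Waits (avgWeight w (z 0)) (fun i => avgWeight w (z (i + 1))) u j then 1 else 0) *
        (‖snis w f (z (j + 1)) - c‖ₑ *
          sojourn (avgWeight w (z (j + 1))) (fun i => avgWeight w (z (j + 1 + i + 1)))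
            (fun i => u (j + 1 + i))) := by
  set a := avgWeight w (z 0)
  set b : ℕ → ℝ := fun i => avgWeight w (z (i + 1)) with hb
  obtain ⟨T, hw, hr⟩ : ∃ T, Waits a b u T ∧ ¬ b T / a ≤ u T := by
    have h0 : Nat.find hT ≠ 0 := fun h0 => Nat.find_spec hT (by
      rw [h0]; exact fun i hi => absurd hi (by simp))
    obtain ⟨T, hT'⟩ := Nat.exists_eq_succ_of_ne_zero h0
    have h1 : Waits a b u T := not_not.1 (Nat.find_min hT (by omega))
    refine ⟨T, h1, fun h2 => Nat.find_spec hT ?_⟩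
    rw [hT']
    intro i hi
    rcases Nat.lt_succ_iff_lt_or_eq.1 hi with h | rfl
    · exact h1 i h
    · exact h2
  have hm := laggedPair_meet hA hu (hu0 T) hw hr
  refine ⟨⟨T, hm⟩, ?_⟩
  -- The leading chain stays at `z 0` for all `T` correction terms; with the initial term this makes
  -- `T + 1` copies, and centring every term leaves a single `c`.
  have e : uis w f z u - c = ((T + 1 : ℕ) : ℝ) * (snis w f (z 0) - c)
      - ∑ k ∈ Finset.range T, (snis w f (laggedPair w z u k).2 - c) := by
    rw [uis_eq_sum_range hm le_rfl]
    have : ∀ k ∈ Finset.range T, snis w f (laggedPair w z u k).1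
        - snis w f (laggedPair w z u k).2
        = (snis w f (z 0) - c) - (snis w f (laggedPair w z u k).2 - c) := fun k hk => by
      rw [(laggedPair_of_waits hA hu k (hw.mono (Finset.mem_range.1 hk))).1]; ring
    rw [Finset.sum_congr rfl this, Finset.sum_sub_distrib, Finset.sum_const, Finset.card_range]
    push_cast
    simp only [nsmul_eq_mul]
    ring
  rw [e]
  refine (enorm_sub_le).trans (add_le_add ?_ ?_)
  · rw [enorm_mul, mul_comm]
    gcongr
    refine le_trans (le_of_eq ?_) (natCast_le_sojourn hw)
    rw [Real.enorm_natCast]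
  · exact (enorm_sum_le _ _).trans
      (sum_enorm_laggedPair_snd_le (G := fun x => snis w f x - c) hw)

end Paths

/-! ### Minkowski's inequality for series -/

/-- Finite sums follow from the two-term inequality by induction, and monotone convergence passes to
the series. -/
lemma lintegral_tsum_rpow_le {α : Type*} [MeasurableSpace α] {μ : Measure α} {s : ℝ} (hs : 1 ≤ s)
    {g : ℕ → α → ℝ≥0∞} (hg : ∀ k, Measurable (g k)) :
    ∫⁻ x, (∑' k, g k x) ^ s ∂μ ≤ (∑' k, (∫⁻ x, g k x ^ s ∂μ) ^ (1 / s)) ^ s := by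
  have hs0 : 0 < s := by linarith
  have fin : ∀ n, (∫⁻ x, (∑ k ∈ Finset.range n, g k x) ^ s ∂μ) ^ (1 / s)
      ≤ ∑ k ∈ Finset.range n, (∫⁻ x, g k x ^ s ∂μ) ^ (1 / s) := by
    intro n
    induction n with
    | zero => simp [ENNReal.zero_rpow_of_pos hs0, hs0]
    | succ n ih =>
      simp only [Finset.sum_range_succ]
      have := ENNReal.lintegral_Lp_add_le (μ := μ) (p := s)
        (f := fun x => ∑ k ∈ Finset.range n, g k x) (g := g n)
        (Finset.measurable_sum _ fun k _ => hg k).aemeasurable (hg n).aemeasurable hs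
      exact this.trans (add_le_add_left ih _)
  have e : ∀ x, (∑' k, g k x) ^ s = ⨆ n, (∑ k ∈ Finset.range n, g k x) ^ s := fun x => by
    rw [ENNReal.tsum_eq_iSup_nat]
    exact (ENNReal.orderIsoRpow s hs0).map_iSup _
  simp only [e]
  rw [lintegral_iSup (fun n => (Finset.measurable_sum _ fun k _ => hg k).pow_const s)
    (fun m n hmn x => ENNReal.rpow_le_rpow
      (Finset.sum_le_sum_of_subset (Finset.range_mono hmn)) hs0.le)]
  refine iSup_le fun n => ?_
  have h1 := ENNReal.rpow_le_rpow ((fin n).trans (ENNReal.sum_le_tsum _)) hs0.le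
  rwa [← ENNReal.rpow_mul, one_div_mul_cancel hs0.ne', ENNReal.rpow_one] at h1

/-! ### Measurability of waiting events -/

section WaitsMeasurable

variable {Ω : Type*} [MeasurableSpace Ω] {a : Ω → ℝ} {b u : ℕ → Ω → ℝ}

lemma measurableSet_waits {k : ℕ} (ha : Measurable a) (hb : ∀ i < k, Measurable (b i))
    (hu : ∀ i < k, Measurable (u i)) :
    MeasurableSet {ω | Waits (a ω) (fun i => b i ω) (fun i => u i ω) k} := by
  have : {ω | Waits (a ω) (fun i => b i ω) (fun i => u i ω) k}
      = ⋂ i, ⋂ (_ : i < k), {ω | b i ω / a ω ≤ u i ω} := by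
    ext ω; simp [Waits]
  rw [this]
  exact MeasurableSet.iInter fun i => MeasurableSet.iInter fun hi =>
    measurableSet_le ((hb i hi).div ha) (hu i hi)

open Classical in
lemma measurable_ite_waits {k : ℕ} (ha : Measurable a) (hb : ∀ i < k, Measurable (b i))
    (hu : ∀ i < k, Measurable (u i)) :
    Measurable fun ω => if Waits (a ω) (fun i => b i ω) (fun i => u i ω) k then (1 : ℝ≥0∞)
      else 0 :=
  Measurable.ite (measurableSet_waits ha hb hu) measurable_const measurable_const

lemma measurable_sojourn (ha : Measurable a) (hb : ∀ i, Measurable (b i))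
    (hu : ∀ i, Measurable (u i)) :
    Measurable fun ω => sojourn (a ω) (fun i => b i ω) (fun i => u i ω) :=
  Measurable.tsum fun _ => measurable_ite_waits ha (fun i _ => hb i) fun i _ => hu i

end WaitsMeasurable

/-! ### Independence of the draws -/

section DrawSigma

variable {X Ω : Type*} [MeasurableSpace X] {N : ℕ} {z : ℕ → Ω → Fin N → X} {u : ℕ → Ω → ℝ}

/-- The σ-algebra generated by a single draw. -/
abbrev drawSigma (z : ℕ → Ω → Fin N → X) (u : ℕ → Ω → ℝ) : ℕ ⊕ ℕ → MeasurableSpace Ω :=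
  Sum.elim (fun t => MeasurableSpace.comap (z t) inferInstance)
    (fun t => MeasurableSpace.comap (u t) inferInstance)

lemma measurable_draw_z {S : Set (ℕ ⊕ ℕ)} {t : ℕ} (ht : Sum.inl t ∈ S) :
    Measurable[⨆ i ∈ S, drawSigma z u i] (z t) := by
  have h1 : drawSigma z u (Sum.inl t) ≤ ⨆ i ∈ S, drawSigma z u i :=
    le_iSup₂ (f := fun i (_ : i ∈ S) => drawSigma z u i) (Sum.inl t) ht
  exact (comap_measurable (z t)).mono h1 le_rfl

lemma measurable_draw_u {S : Set (ℕ ⊕ ℕ)} {t : ℕ} (ht : Sum.inr t ∈ S) :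
    Measurable[⨆ i ∈ S, drawSigma z u i] (u t) := by
  have h1 : drawSigma z u (Sum.inr t) ≤ ⨆ i ∈ S, drawSigma z u i :=
    le_iSup₂ (f := fun i (_ : i ∈ S) => drawSigma z u i) (Sum.inr t) ht
  exact (comap_measurable (u t)).mono h1 le_rfl

end DrawSigma

section Input

variable {X Ω : Type*} [MeasurableSpace X] [MeasurableSpace Ω] {N : ℕ} {q : Measure X}
  {P : Measure Ω} {z : ℕ → Ω → Fin N → X} {u : ℕ → Ω → ℝ} {w : X → ℝ}

/-- Lets every bound for the sojourn started at `z 0` apply verbatim to the one started at `z j`. -/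
lemma IsUISInput.shift (h : IsUISInput q P z u) (j : ℕ) :
    IsUISInput q P (fun t => z (j + t)) (fun t => u (j + t)) where
  measurable_z t := h.measurable_z _
  measurable_u t := h.measurable_u _
  law_z t := h.law_z _
  law_u t := h.law_u _
  indep_z := h.indep_z.precomp (add_right_injective j)
  indep_u := h.indep_u.precomp (add_right_injective j)
  indep_z_u := h.indep_z_u.comp (φ := fun (y : ℕ → Fin N → X) t => y (j + t))
    (ψ := fun (y : ℕ → ℝ) t => y (j + t)) (by fun_prop) (by fun_prop)

lemma IsUISInput.drawSigma_le (h : IsUISInput q P z u) (i : ℕ ⊕ ℕ) :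
    drawSigma z u i ≤ ‹MeasurableSpace Ω› := by
  rcases i with t | t
  · exact (h.measurable_z t).comap_le
  · exact (h.measurable_u t).comap_le

/-- Merges the three independence assumptions into one family indexed by `ℕ ⊕ ℕ`, so that functions
of disjoint blocks of draws are independent even when the blocks mix particles and uniforms. -/
lemma IsUISInput.iIndep_drawSigma (h : IsUISInput q P z u) : iIndep (drawSigma z u) P := by
  rw [iIndep_iff]
  intro s g hg
  have hz := (iIndep_iff _ _).1 h.indep_z.iIndep s.toLeft (f := fun t => g (Sum.inl t))
    fun i hi => hg _ (Finset.mem_toLeft.1 hi)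
  have hu := (iIndep_iff _ _).1 h.indep_u.iIndep s.toRight (f := fun t => g (Sum.inr t))
    fun i hi => hg _ (Finset.mem_toRight.1 hi)
  have e : (⋂ i ∈ s, g i) = (⋂ t ∈ s.toLeft, g (Sum.inl t)) ∩ ⋂ t ∈ s.toRight, g (Sum.inr t) := by
    ext ω
    simp [Finset.mem_toLeft, Finset.mem_toRight]
  have ep : ∏ i ∈ s, P (g i)
      = (∏ t ∈ s.toLeft, P (g (Sum.inl t))) * ∏ t ∈ s.toRight, P (g (Sum.inr t)) := by
    rw [← Finset.toLeft_disjSum_toRight (u := s), Finset.prod_disjSum]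
    simp
  rw [e, ep, ← hz, ← hu]
  refine (Indep_iff _ _ _).1 h.indep_z_u _ _ ?_ ?_
  · refine Finset.measurableSet_biInter _ fun t ht => ?_
    have : MeasurableSpace.comap (z t) inferInstance
        ≤ MeasurableSpace.comap (fun ω t => z t ω) inferInstance :=
      ((measurable_pi_apply t).comp (comap_measurable (fun ω t => z t ω))).comap_le
    exact this _ (hg _ (Finset.mem_toLeft.1 ht))
  · refine Finset.measurableSet_biInter _ fun t ht => ?_
    have : MeasurableSpace.comap (u t) inferInstance
        ≤ MeasurableSpace.comap (fun ω t => u t ω) inferInstance :=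
      ((measurable_pi_apply t).comp (comap_measurable (fun ω t => u t ω))).comap_le
    exact this _ (hg _ (Finset.mem_toRight.1 ht))

lemma IsUISInput.indepFun_of_disjoint (h : IsUISInput q P z u) {S T : Set (ℕ ⊕ ℕ)}
    (hST : Disjoint S T) {β γ : Type*} [MeasurableSpace β] [MeasurableSpace γ] {f : Ω → β}
    {g : Ω → γ} (hf : Measurable[⨆ i ∈ S, drawSigma z u i] f)
    (hg : Measurable[⨆ i ∈ T, drawSigma z u i] g) : IndepFun f g P :=
  (IndepFun_iff_Indep _ _ _).2 (indep_of_indep_of_le_left (indep_of_indep_of_le_right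
    (indep_iSup_of_disjoint h.drawSigma_le h.iIndep_drawSigma hST) hg.comap_le) hf.comap_le)

/-- The first draw is independent of all the others. -/
lemma IsUISInput.map_zero_prodMk (h : IsUISInput q P z u) [IsProbabilityMeasure P] :
    P.map (fun ω => (z 0 ω, ((fun i => z (i + 1) ω), fun i => u i ω)))
      = (Measure.pi fun _ => q).prod (P.map fun ω => ((fun i => z (i + 1) ω), fun i => u i ω)) := by
  have mz := h.measurable_z
  have mu := h.measurable_u
  rw [← h.law_z 0]
  refine (indepFun_iff_map_prod_eq_prod_map_map (mz 0).aemeasurable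
    (Measurable.aemeasurable (by fun_prop))).1 ?_
  refine h.indepFun_of_disjoint (S := {Sum.inl 0}) (T := {Sum.inl 0}ᶜ) disjoint_compl_right
    (measurable_draw_z rfl) ?_
  refine Measurable.prodMk ?_ ?_
  · exact @measurable_pi_lambda _ _ _ (_) _ _ fun i => measurable_draw_z (by simp)
  · exact @measurable_pi_lambda _ _ _ (_) _ _ fun i => measurable_draw_u (by simp)

lemma IsUISInput.lintegral_eq (h : IsUISInput q P z u) [IsProbabilityMeasure P]
    [IsProbabilityMeasure q] {H : (Fin N → X) → (ℕ → Fin N → X) → (ℕ → ℝ) → ℝ≥0∞}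
    (hH : Measurable fun y : (Fin N → X) × (ℕ → Fin N → X) × (ℕ → ℝ) => H y.1 y.2.1 y.2.2) :
    ∫⁻ ω, H (z 0 ω) (fun i => z (i + 1) ω) (fun i => u i ω) ∂P
      = ∫⁻ x, ∫⁻ ω, H x (fun i => z (i + 1) ω) (fun i => u i ω) ∂P ∂(Measure.pi fun _ => q) := by
  have mz := h.measurable_z
  have mu := h.measurable_u
  have m1 : Measurable fun ω => ((fun i => z (i + 1) ω), fun i => u i ω) := by fun_prop
  have e := lintegral_map (μ := P) hH
    (g := fun ω => (z 0 ω, ((fun i => z (i + 1) ω), fun i => u i ω))) (by fun_prop)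
  simp only at e
  rw [← e, h.map_zero_prodMk]
  have := Measure.isProbabilityMeasure_map (μ := P) m1.aemeasurable
  rw [lintegral_prod _ hH.aemeasurable]
  refine lintegral_congr fun x => ?_
  rw [lintegral_map (by fun_prop) m1]

/-- A proposal is rejected at a state of weight `a` with probability bounded away from one. -/
lemma IsUISInput.measure_reject_le (h : IsUISInput q P z u) [IsProbabilityMeasure P]
    [IsProbabilityMeasure q] (hw : Measurable w) (hw0 : ∀ᵐ x ∂q, 0 < w x) (hN : 1 ≤ N) {κ : ℝ}
    (hκ : κ ≤ ∫ x, min 1 (avgWeight w x) ∂(Measure.pi fun _ : Fin N => q)) {a : ℝ} (ha : 0 < a)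
    (k : ℕ) :
    P {ω | avgWeight w (z (k + 1) ω) / a ≤ u k ω} ≤ ENNReal.ofReal (1 - κ * min 1 (1 / a)) := by
  have mA := measurable_avgWeight (N := N) hw
  have hind : IndepFun (z (k + 1)) (u k) P :=
    h.indep_z_u.comp (φ := fun y : ℕ → Fin N → X => y (k + 1)) (ψ := fun y : ℕ → ℝ => y k)
      (by fun_prop) (by fun_prop)
  have hmap := (indepFun_iff_map_prod_eq_prod_map_map (h.measurable_z (k + 1)).aemeasurable
    (h.measurable_u k).aemeasurable).1 hind
  rw [h.law_z, h.law_u] at hmap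
  have mS : MeasurableSet {y : (Fin N → X) × ℝ | avgWeight w y.1 / a ≤ y.2} :=
    measurableSet_le ((mA.comp measurable_fst).div_const a) measurable_snd
  have e : P {ω | avgWeight w (z (k + 1) ω) / a ≤ u k ω}
      = P.map (fun ω => (z (k + 1) ω, u k ω)) {y | avgWeight w y.1 / a ≤ y.2} := by
    rw [Measure.map_apply ((h.measurable_z _).prodMk (h.measurable_u _)) mS]; rfl
  rw [e, hmap, Measure.prod_apply mS]
  -- Given the proposal `x`, the rejection probability is the positive part of `1 - Ẑ(x) / a`. The
  -- product of minima separates the state from the proposal, so that integration over `x` produces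
  -- `κ`.
  have hle : ∀ᵐ x ∂(Measure.pi fun _ : Fin N => q),
      (volume.restrict (Set.Ioo (0 : ℝ) 1)) (Prod.mk x ⁻¹' {y | avgWeight w y.1 / a ≤ y.2})
        ≤ ENNReal.ofReal (1 - min 1 (1 / a) * min 1 (avgWeight w x)) := by
    refine (ae_avgWeight_pos hN hw0).mono fun x hx => ?_
    have h1 : (volume.restrict (Set.Ioo (0 : ℝ) 1))
        (Prod.mk x ⁻¹' {y | avgWeight w y.1 / a ≤ y.2}) ≤ volume (Set.Ico (avgWeight w x / a) 1) := by
      rw [Measure.restrict_apply (measurable_prodMk_left mS)]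
      exact measure_mono fun v hv => ⟨hv.1, hv.2.2⟩
    refine h1.trans ?_
    rw [Real.volume_Ico]
    refine ENNReal.ofReal_le_ofReal (sub_le_sub_left ?_ _)
    calc min 1 (1 / a) * min 1 (avgWeight w x) ≤ 1 / a * avgWeight w x := by
          gcongr
          · exact le_min zero_le_one hx.2.le
          · exact min_le_right _ _
          · exact min_le_right _ _
      _ = _ := by ring
  refine (lintegral_mono_ae hle).trans ?_
  have i0 : Integrable (fun x => min 1 (avgWeight w x)) (Measure.pi fun _ : Fin N => q) := by
    refine (integrable_const (1 : ℝ)).mono' (by fun_prop)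
      ((ae_avgWeight_pos hN hw0).mono fun x hx => ?_)
    rw [Real.norm_of_nonneg (le_min zero_le_one hx.2.le)]
    exact min_le_left _ _
  have hm1 : 0 ≤ min 1 (1 / a) := le_min zero_le_one (by positivity)
  have i1 : Integrable (fun x => 1 - min 1 (1 / a) * min 1 (avgWeight w x))
      (Measure.pi fun _ : Fin N => q) := (integrable_const _).sub (i0.const_mul _)
  rw [← ofReal_integral_eq_lintegral_ofReal i1
    ((ae_avgWeight_pos hN hw0).mono fun x hx => ?_)]
  · refine ENNReal.ofReal_le_ofReal ?_
    rw [integral_sub (integrable_const _) (i0.const_mul _), integral_const_mul, integral_const,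
      probReal_univ, one_smul, mul_comm κ]
    gcongr
  · have := mul_le_one₀ (min_le_left 1 (1 / a)) (le_min zero_le_one hx.2.le)
      (min_le_left 1 (avgWeight w x))
    simpa using this

lemma IsUISInput.measure_waits_le (h : IsUISInput q P z u) [IsProbabilityMeasure P]
    [IsProbabilityMeasure q] (hw : Measurable w) (hw0 : ∀ᵐ x ∂q, 0 < w x) (hN : 1 ≤ N) {κ : ℝ}
    (hκ : κ ≤ ∫ x, min 1 (avgWeight w x) ∂(Measure.pi fun _ : Fin N => q)) {a : ℝ} (ha : 0 < a)
    (k : ℕ) :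
    P {ω | Waits a (fun i => avgWeight w (z (i + 1) ω)) (fun i => u i ω) k}
      ≤ ENNReal.ofReal (1 - κ * min 1 (1 / a)) ^ k := by
  have mA := measurable_avgWeight (N := N) hw
  induction k with
  | zero => simpa using prob_le_one
  | succ k ih =>
    have e : {ω | Waits a (fun i => avgWeight w (z (i + 1) ω)) (fun i => u i ω) (k + 1)}
        = {ω | Waits a (fun i => avgWeight w (z (i + 1) ω)) (fun i => u i ω) k}
          ∩ {ω | avgWeight w (z (k + 1) ω) / a ≤ u k ω} := by
      ext ω
      simp only [Waits, Set.mem_ofPred_eq, Set.mem_inter_iff]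
      exact Nat.forall_lt_succ_right
    -- Rejection number `k` uses exactly these two draws, none of which enters the first `k`
    -- rejections.
    set S : Set (ℕ ⊕ ℕ) := {Sum.inl (k + 1), Sum.inr k} with hS
    have hI := indep_iSup_of_disjoint h.drawSigma_le h.iIndep_drawSigma
      (disjoint_compl_left : Disjoint Sᶜ S)
    rw [e, (Indep_iff _ _ _).1 hI _ _ ?_ ?_, pow_succ]
    · exact mul_le_mul' ih (h.measure_reject_le hw hw0 hN hκ ha k)
    · refine @measurableSet_waits _ (_) _ _ _ _ (@measurable_const _ _ _ (_) a) ?_ ?_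
      · exact fun i hi => mA.comp (measurable_draw_z (by simp [hS]; omega))
      · exact fun i hi => measurable_draw_u (by simp [hS]; omega)
    · exact (((mA.comp (measurable_draw_z (Or.inl rfl))).div_const a).prodMk
        (measurable_draw_u (Or.inr rfl))) measurableSet_le'

end Input

/-! ### Moments of the average weight -/

section AverageWeight

variable {X : Type*} [MeasurableSpace X] {q : Measure X} {w : X → ℝ} {N : ℕ}

lemma integral_abs_avgWeight_rpow_le [IsProbabilityMeasure q] (hw : Measurable w) {t : ℝ}
    (ht : 1 ≤ t) (iw : Integrable (fun x => |w x| ^ t) q) (hN : 1 ≤ N) :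
    Integrable (fun x => |avgWeight w x| ^ t) (Measure.pi fun _ : Fin N => q) ∧
      ∫ x, |avgWeight w x| ^ t ∂(Measure.pi fun _ : Fin N => q) ≤ ∫ x, |w x| ^ t ∂q := by
  have hN0 : (0 : ℝ) < N := by exact_mod_cast hN
  have mA := measurable_avgWeight (N := N) hw
  have hle : ∀ x : Fin N → X, |avgWeight w x| ^ t ≤ ∑ n, (N : ℝ)⁻¹ * |w (x n)| ^ t := fun x => by
    refine le_trans ?_ (Real.rpow_arith_mean_le_arith_mean_rpow Finset.univ
      (fun _ : Fin N => (N : ℝ)⁻¹) (fun n => |w (x n)|) (fun _ _ => by positivity)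
      (by simp [hN0.ne']) (fun _ _ => abs_nonneg _) ht)
    refine Real.rpow_le_rpow (abs_nonneg _) ?_ (by linarith)
    rw [avgWeight, abs_mul, abs_of_pos (by positivity : (0 : ℝ) < (N : ℝ)⁻¹), ← Finset.mul_sum]
    gcongr
    exact Finset.abs_sum_le_sum_abs _ _
  have i1 : ∀ n ∈ Finset.univ, Integrable (fun x : Fin N → X => (N : ℝ)⁻¹ * |w (x n)| ^ t)
      (Measure.pi fun _ => q) := fun n _ =>
    ((measurePreserving_eval (fun _ : Fin N => q) n).integrable_comp_of_integrable iw).const_mul _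
  have I : Integrable (fun x => |avgWeight w x| ^ t) (Measure.pi fun _ : Fin N => q) :=
    (integrable_finsetSum _ i1).mono' (mA.abs.pow_const t).aestronglyMeasurable
      (ae_of_all _ fun x => by rw [Real.norm_of_nonneg (by positivity)]; exact hle x)
  refine ⟨I, (integral_mono I (integrable_finsetSum _ i1) hle).trans (le_of_eq ?_)⟩
  rw [integral_finsetSum _ i1]
  have : ∀ n : Fin N, ∫ x : Fin N → X, (N : ℝ)⁻¹ * |w (x n)| ^ t ∂(Measure.pi fun _ => q)
      = (N : ℝ)⁻¹ * ∫ x, |w x| ^ t ∂q := fun n => by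
    rw [integral_const_mul, integral_comp_eval (X := fun _ => X) (μ := fun _ => q) (i := n)
        (f := fun y => |w y| ^ t) iw.aestronglyMeasurable]
  simp only [this, Finset.sum_const, Finset.card_univ, Fintype.card_fin, nsmul_eq_mul]
  field_simp

lemma integral_avgWeight [IsProbabilityMeasure q] (iw : Integrable w q) (hN : 1 ≤ N) :
    Integrable (avgWeight w) (Measure.pi fun _ : Fin N => q) ∧
      ∫ x, avgWeight w x ∂(Measure.pi fun _ : Fin N => q) = ∫ x, w x ∂q := by
  have hN0 : (0 : ℝ) < N := by exact_mod_cast hN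
  have i1 : ∀ n ∈ Finset.univ, Integrable (fun x : Fin N → X => w (x n))
      (Measure.pi fun _ => q) := fun n _ =>
    (measurePreserving_eval (fun _ : Fin N => q) n).integrable_comp_of_integrable iw
  refine ⟨(integrable_finsetSum _ i1).const_mul _, ?_⟩
  unfold avgWeight
  rw [integral_const_mul, integral_finsetSum _ i1]
  have : ∀ n : Fin N, ∫ x : Fin N → X, w (x n) ∂(Measure.pi fun _ => q) = ∫ x, w x ∂q := fun n =>
    integral_comp_eval (X := fun _ => X) (μ := fun _ => q) (i := n) iw.aestronglyMeasurable
  simp only [this, Finset.sum_const, Finset.card_univ, Fintype.card_fin, nsmul_eq_mul]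
  field_simp

/-- A proposal is accepted with non-negligible probability. -/
lemma le_integral_min_one_avgWeight [IsProbabilityMeasure q] {p Aw : ℝ} (hp : 2 ≤ p)
    (hw : Measurable w) (hw0 : ∀ᵐ x ∂q, 0 < w x) (hw1 : ∫ x, w x ∂q = 1)
    (iw : Integrable (fun x => |w x| ^ p) q) (bw : ∫ x, |w x| ^ p ∂q ≤ Aw) (hN : 1 ≤ N) :
    3 / (4 * (1 + Aw)) ≤ ∫ x, min 1 (avgWeight w x) ∂(Measure.pi fun _ : Fin N => q) := by
  have hAw : 0 ≤ Aw := le_trans (integral_nonneg fun x => by positivity) bw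
  have mA := measurable_avgWeight (N := N) hw
  set M := 1 + Aw with hM
  have hM0 : 0 < M := by linarith
  have iw2 : Integrable (fun x => |w x| ^ (2 : ℝ)) q :=
    integrable_abs_rpow_of_le (by norm_num) hp iw
  have iw1 : Integrable w q := by
    have := integrable_abs_rpow_of_le zero_le_one (by linarith) iw
    exact this.mono' hw.aestronglyMeasurable (ae_of_all _ fun x => by simp)
  have b2 : ∫ x, |w x| ^ (2 : ℝ) ∂q ≤ M := by
    have : ∫ x, |w x| ^ (2 : ℝ) ∂q ≤ ∫ x, (1 + |w x| ^ p) ∂q :=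
      integral_mono iw2 ((integrable_const _).add iw) fun x =>
        rpow_le_one_add_rpow (abs_nonneg _) (by norm_num) hp
    rw [integral_add (integrable_const _) iw, integral_const, probReal_univ, one_smul] at this
    linarith
  obtain ⟨I2, B2⟩ := integral_abs_avgWeight_rpow_le hw (t := 2) (by norm_num) iw2 hN
  obtain ⟨I1, B1⟩ := integral_avgWeight iw1 hN
  have hpos := ae_avgWeight_pos hN hw0
  have i0 : Integrable (fun x => min 1 (avgWeight w x)) (Measure.pi fun _ : Fin N => q) := by
    refine (integrable_const (1 : ℝ)).mono' (by fun_prop) (hpos.mono fun x hx => ?_)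
    rw [Real.norm_of_nonneg (le_min zero_le_one hx.2.le)]
    exact min_le_left _ _
  -- The parabola `A / M - A² / (4 M²) = 1 - (1 - A / (2 M))²` lies below both `1` and `A`. Only the
  -- mean, which is one, and the second moment, at most `M`, are then needed, which makes the bound
  -- uniform in `N`.
  have hle : ∫ x, (1 / M * avgWeight w x - 1 / (4 * M ^ 2) * |avgWeight w x| ^ (2 : ℝ))
      ∂(Measure.pi fun _ : Fin N => q)
      ≤ ∫ x, min 1 (avgWeight w x) ∂(Measure.pi fun _ : Fin N => q) := by
    refine integral_mono_ae ((I1.const_mul _).sub (I2.const_mul _)) i0 (hpos.mono fun x hx => ?_)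
    simp only [Real.rpow_two, sq_abs]
    refine le_min ?_ ?_
    · have e : 1 / M * avgWeight w x - 1 / (4 * M ^ 2) * avgWeight w x ^ 2
          = 1 - (1 - avgWeight w x / (2 * M)) ^ 2 := by field_simp; ring
      rw [e]; linarith [sq_nonneg (1 - avgWeight w x / (2 * M))]
    · have h1 : 1 / M ≤ 1 := by rw [div_le_one hM0]; linarith
      have h2 : 0 ≤ 1 / (4 * M ^ 2) * avgWeight w x ^ 2 := by positivity
      nlinarith [hx.2]
  rw [integral_sub (I1.const_mul _) (I2.const_mul _), integral_const_mul, integral_const_mul, B1,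
    hw1] at hle
  refine le_trans ?_ hle
  have : 1 / (4 * M ^ 2) * ∫ x, |avgWeight w x| ^ (2 : ℝ) ∂(Measure.pi fun _ : Fin N => q)
      ≤ 1 / (4 * M ^ 2) * M := by
    gcongr
    exact B2.trans b2
  have e : 3 / (4 * M) = 1 / M * 1 - 1 / (4 * M ^ 2) * M := by field_simp; norm_num
  rw [e]
  linarith

end AverageWeight

/-! ### Sojourn times -/

/-- The left side is the sum of a geometric series of `L^s` norms; by Bernoulli its ratio `(1 - α) ^
(1 / s)` is at most `1 - α / s`. -/
lemma inv_one_sub_rpow_le {α s : ℝ} (hα0 : 0 < α) (hα1 : α ≤ 1) (hs : 1 ≤ s) :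
    (1 - ENNReal.ofReal (1 - α) ^ (1 / s))⁻¹ ≤ ENNReal.ofReal (s / α) := by
  have hs0 : 0 < s := by linarith
  have h1 : (1 - α) ^ (1 / s) ≤ 1 - α / s := by
    have := rpow_one_add_le_one_add_mul_self (s := -α) (by linarith) (p := 1 / s) (by positivity)
      ((div_le_one hs0).2 hs)
    calc (1 - α) ^ (1 / s) = (1 + -α) ^ (1 / s) := by ring_nf
      _ ≤ _ := this
      _ = _ := by ring
  rw [ENNReal.ofReal_rpow_of_nonneg (by linarith) (by positivity)]
  have h2 : ENNReal.ofReal (α / s) ≤ 1 - ENNReal.ofReal ((1 - α) ^ (1 / s)) := by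
    rw [← ENNReal.ofReal_one, ← ENNReal.ofReal_sub _ (Real.rpow_nonneg (by linarith) _)]
    exact ENNReal.ofReal_le_ofReal (by linarith)
  calc (1 - ENNReal.ofReal ((1 - α) ^ (1 / s)))⁻¹ ≤ (ENNReal.ofReal (α / s))⁻¹ :=
        ENNReal.inv_le_inv.2 h2
    _ = ENNReal.ofReal (s / α) := by
        rw [← ENNReal.ofReal_inv_of_pos (by positivity), inv_div]

/-- From `1 - α ≤ exp (-α)` and `jα / p ≤ exp (jα / p)`. The geometric decay is given up for a
negative power of `α`, which can be integrated when `α` depends on a random weight. -/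
lemma one_sub_pow_le {α p : ℝ} (hα0 : 0 < α) (hα1 : α ≤ 1) (hp : 0 < p) {j : ℕ} (hj : 1 ≤ j) :
    (1 - α) ^ j ≤ p ^ p * (j : ℝ) ^ (-p) * α ^ (-p) := by
  have hj0 : (0 : ℝ) < j := by exact_mod_cast hj
  have h1 : (1 - α) ^ j ≤ Real.exp (-(j * α)) := by
    calc (1 - α) ^ j ≤ Real.exp (-α) ^ j :=
          pow_le_pow_left₀ (by linarith) (by linarith [Real.add_one_le_exp (-α)]) j
      _ = _ := by rw [← Real.exp_nat_mul]; ring_nf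
  refine h1.trans ?_
  have h2 : (j * α / p) ^ p ≤ Real.exp (j * α) := by
    calc (j * α / p) ^ p ≤ Real.exp (j * α / p) ^ p :=
          Real.rpow_le_rpow (by positivity) (by linarith [Real.add_one_le_exp (j * α / p)]) hp.le
      _ = _ := by rw [← Real.exp_mul]; congr 1; field_simp
  rw [Real.exp_neg]
  calc (Real.exp (j * α))⁻¹ ≤ ((j * α / p) ^ p)⁻¹ := inv_anti₀ (by positivity) h2
    _ = _ := by
      rw [Real.div_rpow (by positivity) hp.le, Real.mul_rpow hj0.le hα0.le, Real.rpow_neg hj0.le,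
        Real.rpow_neg hα0.le]
      field_simp

section Sojourn

variable {X Ω : Type*} [MeasurableSpace X] [MeasurableSpace Ω] {N : ℕ} {q : Measure X}
  {P : Measure Ω} {z : ℕ → Ω → Fin N → X} {u : ℕ → Ω → ℝ} {w : X → ℝ}

lemma rate_pos {κ a : ℝ} (hκ0 : 0 < κ) (ha : 0 < a) : 0 < κ * min 1 (1 / a) :=
  mul_pos hκ0 (lt_min one_pos (by positivity))

lemma rate_le_one {κ a : ℝ} (hκ1 : κ ≤ 1) (ha : 0 < a) : κ * min 1 (1 / a) ≤ 1 :=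
  mul_le_one₀ hκ1 (le_min zero_le_one (by positivity)) (min_le_left _ _)

lemma inv_rate {κ a : ℝ} (ha : 0 < a) : (κ * min 1 (1 / a))⁻¹ = κ⁻¹ * max 1 a := by
  rw [mul_inv]
  congr 1
  rcases le_total 1 a with h | h
  · rw [max_eq_right h, min_eq_right ((div_le_one ha).2 h), one_div, inv_inv]
  · rw [max_eq_left h, min_eq_left ((one_le_div ha).2 h), inv_one]

lemma max_one_rpow_le {a t : ℝ} (ha : 0 ≤ a) : max 1 a ^ t ≤ 1 + a ^ t := by
  have := Real.rpow_nonneg ha t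
  rcases max_choice 1 a with h | h <;> rw [h]
  · rw [Real.one_rpow]; linarith
  · linarith

/-- A sojourn is a sum of indicators whose `L^s` norms are `s`-th roots of geometrically decaying
probabilities, so Minkowski's inequality reduces its norm to a geometric series. -/
lemma IsUISInput.lintegral_sojourn_rpow_le (h : IsUISInput q P z u) [IsProbabilityMeasure P]
    [IsProbabilityMeasure q] (hw : Measurable w) (hw0 : ∀ᵐ x ∂q, 0 < w x) (hN : 1 ≤ N) {κ : ℝ}
    (hκ0 : 0 < κ) (hκ1 : κ ≤ 1)
    (hκ : κ ≤ ∫ x, min 1 (avgWeight w x) ∂(Measure.pi fun _ : Fin N => q)) {a s : ℝ} (ha : 0 < a)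
    (hs : 1 ≤ s) :
    ∫⁻ ω, sojourn a (fun i => avgWeight w (z (i + 1) ω)) (fun i => u i ω) ^ s ∂P
      ≤ ENNReal.ofReal (s / (κ * min 1 (1 / a))) ^ s := by
  classical
  have hs0 : 0 < s := by linarith
  have mA := measurable_avgWeight (N := N) hw
  have mb : ∀ i, Measurable fun ω => avgWeight w (z i ω) := fun i => mA.comp (h.measurable_z i)
  unfold sojourn
  refine (lintegral_tsum_rpow_le hs fun k => measurable_ite_waits measurable_const
    (fun i _ => mb (i + 1)) fun i _ => h.measurable_u i).trans ?_
  refine ENNReal.rpow_le_rpow ?_ hs0.le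
  have hk : ∀ k, (∫⁻ ω, (if Waits a (fun i => avgWeight w (z (i + 1) ω)) (fun i => u i ω) k
      then (1 : ℝ≥0∞) else 0) ^ s ∂P) ^ (1 / s)
      ≤ (ENNReal.ofReal (1 - κ * min 1 (1 / a)) ^ (1 / s)) ^ k := fun k => by
    have e : ∀ ω, (if Waits a (fun i => avgWeight w (z (i + 1) ω)) (fun i => u i ω) k
        then (1 : ℝ≥0∞) else 0) ^ s = {ω | Waits a (fun i => avgWeight w (z (i + 1) ω))
          (fun i => u i ω) k}.indicator 1 ω := fun ω => by
      by_cases hc : Waits a (fun i => avgWeight w (z (i + 1) ω)) (fun i => u i ω) k <;>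
        simp [hc, hs0]
    simp only [e]
    rw [lintegral_indicator_one (measurableSet_waits measurable_const (fun i _ => mb (i + 1))
      fun i _ => h.measurable_u i), ← ENNReal.rpow_natCast, ← ENNReal.rpow_mul, mul_comm (1 / s),
      ENNReal.rpow_mul, ENNReal.rpow_natCast]
    exact ENNReal.rpow_le_rpow (h.measure_waits_le hw hw0 hN hκ ha k) (by positivity)
  refine (ENNReal.tsum_le_tsum hk).trans ?_
  rw [ENNReal.tsum_geometric]
  exact inv_one_sub_rpow_le (rate_pos hκ0 ha) (rate_le_one hκ1 ha) hs

/-- The contribution of one sojourn, in terms of moments of the starting point only. -/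
lemma IsUISInput.lintegral_enorm_mul_sojourn_rpow_le (h : IsUISInput q P z u)
    [IsProbabilityMeasure P] [IsProbabilityMeasure q] (hw : Measurable w)
    (hw0 : ∀ᵐ x ∂q, 0 < w x) (hN : 1 ≤ N) {κ : ℝ} (hκ0 : 0 < κ) (hκ1 : κ ≤ 1)
    (hκ : κ ≤ ∫ x, min 1 (avgWeight w x) ∂(Measure.pi fun _ : Fin N => q)) {s : ℝ}
    (hs : 1 ≤ s) {G : (Fin N → X) → ℝ} (hG : Measurable G)
    (iG : Integrable (fun x => |G x| ^ s + |avgWeight w x * G x| ^ s)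
      (Measure.pi fun _ : Fin N => q)) :
    ∫⁻ ω, (‖G (z 0 ω)‖ₑ * sojourn (avgWeight w (z 0 ω)) (fun i => avgWeight w (z (i + 1) ω))
        (fun i => u i ω)) ^ s ∂P
      ≤ ENNReal.ofReal ((s / κ) ^ s * ∫ x, (|G x| ^ s + |avgWeight w x * G x| ^ s)
        ∂(Measure.pi fun _ : Fin N => q)) := by
  have hs0 : 0 < s := by linarith
  have mA := measurable_avgWeight (N := N) hw
  have mb : ∀ i, Measurable fun ω => avgWeight w (z i ω) := fun i => mA.comp (h.measurable_z i)
  have mH : Measurable fun y : (Fin N → X) × (ℕ → Fin N → X) × (ℕ → ℝ) =>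
      (‖G y.1‖ₑ * sojourn (avgWeight w y.1) (fun i => avgWeight w (y.2.1 i)) y.2.2) ^ s := by
    refine ((hG.comp measurable_fst).enorm.mul ?_).pow_const s
    exact measurable_sojourn (mA.comp measurable_fst)
      (b := fun i (y : (Fin N → X) × (ℕ → Fin N → X) × (ℕ → ℝ)) => avgWeight w (y.2.1 i))
      (u := fun i y => y.2.2 i) (fun i => mA.comp (by fun_prop)) (fun i => by fun_prop)
  rw [h.lintegral_eq (H := fun x y v =>
    (‖G x‖ₑ * sojourn (avgWeight w x) (fun i => avgWeight w (y i)) v) ^ s) mH,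
    ← integral_const_mul, ofReal_integral_eq_lintegral_ofReal (iG.const_mul _)
      (ae_of_all _ fun x => by positivity)]
  refine lintegral_mono_ae ((ae_avgWeight_pos hN hw0).mono fun x hx => ?_)
  have hA := hx.2
  simp only [ENNReal.mul_rpow_of_nonneg _ _ hs0.le]
  rw [lintegral_const_mul _ ((measurable_sojourn measurable_const (fun i => mb (i + 1))
    h.measurable_u).pow_const s)]
  refine (mul_le_mul_right (h.lintegral_sojourn_rpow_le hw hw0 hN hκ0 hκ1 hκ hA hs) _).trans ?_
  have hr := rate_pos hκ0 hA
  rw [Real.enorm_eq_ofReal_abs, ENNReal.ofReal_rpow_of_nonneg (abs_nonneg _) hs0.le,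
    ENNReal.ofReal_rpow_of_nonneg (by positivity) hs0.le, ← ENNReal.ofReal_mul (by positivity)]
  refine ENNReal.ofReal_le_ofReal ?_
  -- The inverse acceptance rate is `κ⁻¹ max(1, Ẑ)`; this is where the term `|Ẑ G| ^ s` comes from.
  rw [div_eq_mul_inv s, inv_rate hA, ← mul_assoc, ← div_eq_mul_inv,
    Real.mul_rpow (by positivity) (by positivity), abs_mul,
    Real.mul_rpow (abs_nonneg _) (abs_nonneg _), abs_of_pos hA]
  have := mul_le_mul_of_nonneg_left (max_one_rpow_le (t := s) hA.le)
    (show 0 ≤ |G x| ^ s * (s / κ) ^ s by positivity)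
  linarith

/-- Polynomial tails of the meeting time. -/
lemma IsUISInput.measure_waits_zero_le (h : IsUISInput q P z u)
    [IsProbabilityMeasure P] [IsProbabilityMeasure q] (hw : Measurable w)
    (hw0 : ∀ᵐ x ∂q, 0 < w x) (hN : 1 ≤ N) {κ : ℝ} (hκ0 : 0 < κ) (hκ1 : κ ≤ 1)
    (hκ : κ ≤ ∫ x, min 1 (avgWeight w x) ∂(Measure.pi fun _ : Fin N => q)) {p Aw : ℝ}
    (hp : 1 ≤ p) (iw : Integrable (fun x => |w x| ^ p) q) (bw : ∫ x, |w x| ^ p ∂q ≤ Aw)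
    {j : ℕ} (hj : 1 ≤ j) :
    P {ω | Waits (avgWeight w (z 0 ω)) (fun i => avgWeight w (z (i + 1) ω)) (fun i => u i ω) j}
      ≤ ENNReal.ofReal ((p / κ) ^ p * (1 + Aw) * (j : ℝ) ^ (-p)) := by
  classical
  have hp0 : 0 < p := by linarith
  have mA := measurable_avgWeight (N := N) hw
  have mb : ∀ i, Measurable fun ω => avgWeight w (z i ω) := fun i => mA.comp (h.measurable_z i)
  have e : ∀ a, (fun ω => if Waits a (fun i => avgWeight w (z (i + 1) ω)) (fun i => u i ω) j
      then (1 : ℝ≥0∞) else 0) = {ω | Waits a (fun i => avgWeight w (z (i + 1) ω))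
        (fun i => u i ω) j}.indicator 1 := fun a => by
    ext ω
    by_cases hc : Waits a (fun i => avgWeight w (z (i + 1) ω)) (fun i => u i ω) j <;> simp [hc]
  have e0 : (fun ω => if Waits (avgWeight w (z 0 ω)) (fun i => avgWeight w (z (i + 1) ω))
      (fun i => u i ω) j then (1 : ℝ≥0∞) else 0) = {ω | Waits (avgWeight w (z 0 ω))
        (fun i => avgWeight w (z (i + 1) ω)) (fun i => u i ω) j}.indicator 1 := by
    ext ω
    by_cases hc : Waits (avgWeight w (z 0 ω)) (fun i => avgWeight w (z (i + 1) ω))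
      (fun i => u i ω) j <;> simp [hc]
  rw [← lintegral_indicator_one (measurableSet_waits (mb 0) (fun i _ => mb (i + 1))
      fun i _ => h.measurable_u i), ← e0]
  have mH : Measurable fun y : (Fin N → X) × (ℕ → Fin N → X) × (ℕ → ℝ) =>
      if Waits (avgWeight w y.1) (fun i => avgWeight w (y.2.1 i)) y.2.2 j
        then (1 : ℝ≥0∞) else 0 :=
    measurable_ite_waits (mA.comp measurable_fst)
      (b := fun i (y : (Fin N → X) × (ℕ → Fin N → X) × (ℕ → ℝ)) => avgWeight w (y.2.1 i))
      (u := fun i y => y.2.2 i) (fun i _ => mA.comp (by fun_prop)) (fun i _ => by fun_prop)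
  rw [h.lintegral_eq (H := fun x y v =>
    if Waits (avgWeight w x) (fun i => avgWeight w (y i)) v j then (1 : ℝ≥0∞) else 0) mH]
  obtain ⟨IA, BA⟩ := integral_abs_avgWeight_rpow_le hw hp iw hN
  have iD : Integrable (fun x => (p / κ) ^ p * (j : ℝ) ^ (-p) * (1 + |avgWeight w x| ^ p))
      (Measure.pi fun _ : Fin N => q) := ((integrable_const _).add IA).const_mul _
  calc _ ≤ ∫⁻ x, ENNReal.ofReal ((p / κ) ^ p * (j : ℝ) ^ (-p) * (1 + |avgWeight w x| ^ p))
        ∂(Measure.pi fun _ : Fin N => q) := by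
        refine lintegral_mono_ae ((ae_avgWeight_pos hN hw0).mono fun x hx => ?_)
        have hA := hx.2
        rw [e, lintegral_indicator_one (measurableSet_waits measurable_const
          (fun i _ => mb (i + 1)) fun i _ => h.measurable_u i)]
        refine (h.measure_waits_le hw hw0 hN hκ hA j).trans ?_
        have hr0 := rate_pos hκ0 hA
        have hr1 := rate_le_one hκ1 hA
        rw [← ENNReal.ofReal_pow (by linarith)]
        refine ENNReal.ofReal_le_ofReal ((one_sub_pow_le hr0 hr1 hp0 hj).trans ?_)
        rw [Real.rpow_neg hr0.le, ← Real.inv_rpow hr0.le, inv_rate hA,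
          Real.mul_rpow (by positivity) (by positivity), Real.inv_rpow hκ0.le,
          Real.div_rpow hp0.le hκ0.le, abs_of_pos hA]
        have := mul_le_mul_of_nonneg_left (max_one_rpow_le (t := p) hA.le)
          (show 0 ≤ p ^ p * (j : ℝ) ^ (-p) * (κ ^ p)⁻¹ by positivity)
        rw [div_eq_mul_inv]
        linarith
    _ ≤ _ := by
        rw [← ofReal_integral_eq_lintegral_ofReal iD (ae_of_all _ fun x => by positivity)]
        refine ENNReal.ofReal_le_ofReal ?_
        rw [integral_const_mul, integral_add (integrable_const _) IA, integral_const,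
          probReal_univ, one_smul, mul_assoc, mul_comm ((j : ℝ) ^ (-p)), ← mul_assoc]
        gcongr
        exact BA.trans bw

end Sojourn

/-! ### The moment bound -/

/-- The `s`-th root of the tail `D * j ^ (-p)`, summed over all times. -/
noncomputable def tailSum (D p s : ℝ) : ℝ≥0∞ :=
  2 + ∑' j : ℕ, ENNReal.ofReal (D * ((j + 1 : ℕ) : ℝ) ^ (-p)) ^ (1 / s)

lemma tailSum_ne_top {D p s : ℝ} (hD : 0 ≤ D) (hs : 0 < s) (hsp : s < p) : tailSum D p s ≠ ⊤ := by
  refine ENNReal.add_ne_top.2 ⟨by norm_num, ?_⟩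
  have e : ∀ j : ℕ, ENNReal.ofReal (D * ((j + 1 : ℕ) : ℝ) ^ (-p)) ^ (1 / s)
      = ENNReal.ofReal (D ^ (1 / s) * ((j + 1 : ℕ) : ℝ) ^ (-(p / s))) := fun j => by
    rw [ENNReal.ofReal_rpow_of_nonneg (by positivity) (by positivity),
      Real.mul_rpow hD (by positivity), ← Real.rpow_mul (by positivity)]
    congr 3; field_simp
  simp only [e]
  have hsum : Summable fun j : ℕ => D ^ (1 / s) * ((j + 1 : ℕ) : ℝ) ^ (-(p / s)) := by
    refine Summable.mul_left _ ((summable_nat_add_iff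
      (f := fun j : ℕ => (j : ℝ) ^ (-(p / s))) 1).2 (Real.summable_nat_rpow.2 ?_))
    rw [neg_lt_neg_iff, one_lt_div hs]; exact hsp
  exact hsum.tsum_ofReal_ne_top

/-- The constant of the moment bound for the unbiased importance sampling estimator. -/
noncomputable def uisConst (s p r Aw Af Ah : ℝ) : ℝ :=
  (s / (3 / (4 * (1 + Aw)))) ^ s * momentConst s p r Aw Af Ah *
    (tailSum ((p / (3 / (4 * (1 + Aw)))) ^ p * (1 + Aw)) p s ^ s).toReal

section Core

variable {X Ω : Type*} [MeasurableSpace X] [MeasurableSpace Ω] {N : ℕ} {q : Measure X}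
  {P : Measure Ω} {z : ℕ → Ω → Fin N → X} {u : ℕ → Ω → ℝ} {w f : X → ℝ}

lemma measurable_laggedPair (hw : Measurable w) (hz : ∀ t, Measurable (z t))
    (hu : ∀ t, Measurable (u t)) (k : ℕ) :
    Measurable fun ω => laggedPair w (fun t => z t ω) (fun t => u t ω) k := by
  have mA := measurable_avgWeight (N := N) hw
  have step : ∀ {x x' : Ω → Fin N → X} {v : Ω → ℝ}, Measurable x → Measurable x' →
      Measurable v → Measurable fun ω => pimhStep w (x ω) (x' ω) (v ω) := fun hx hx' hv =>
    Measurable.ite (measurableSet_lt hv ((mA.comp hx').div (mA.comp hx))) hx' hx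
  induction k with
  | zero => exact (step (hz 0) (hz 1) (hu 0)).prodMk (hz 1)
  | succ k ih => exact (step ih.fst (hz _) (hu _)).prodMk (step ih.snd (hz _) (hu _))

lemma IsUISInput.ae_draws (h : IsUISInput q P z u) [IsProbabilityMeasure q] (hN : 1 ≤ N)
    (hw0 : ∀ᵐ x ∂q, 0 < w x) :
    ∀ᵐ ω ∂P, (∀ t, 0 < avgWeight w (z t ω)) ∧ (∀ t, 0 < u t ω) ∧ ∀ t, u t ω < 1 := by
  have h1 : ∀ᵐ ω ∂P, ∀ t, 0 < avgWeight w (z t ω) := ae_all_iff.2 fun t => by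
    have := ae_avgWeight_pos hN hw0
    rw [← h.law_z t] at this
    exact (ae_of_ae_map (h.measurable_z t).aemeasurable this).mono fun ω hω => hω.2
  have h2 : ∀ᵐ ω ∂P, ∀ t, u t ω ∈ Set.Ioo (0 : ℝ) 1 := ae_all_iff.2 fun t => by
    have : ∀ᵐ v ∂(volume.restrict (Set.Ioo (0 : ℝ) 1)), v ∈ Set.Ioo (0 : ℝ) 1 :=
      ae_restrict_mem measurableSet_Ioo
    rw [← h.law_u t] at this
    exact ae_of_ae_map (h.measurable_u t).aemeasurable this
  filter_upwards [h1, h2] with ω a b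
  exact ⟨a, fun t => (b t).1, fun t => (b t).2⟩

open Classical in
/-- Minkowski's inequality over the sojourns of the lagging chain, each of which is independent of
the event that the leading chain has not moved before. -/
lemma IsUISInput.lintegral_tsum_sojourn_rpow_le (h : IsUISInput q P z u) [IsProbabilityMeasure P]
    [IsProbabilityMeasure q] (hw : Measurable w) {s : ℝ} (hs : 1 ≤ s) {G : (Fin N → X) → ℝ}
    (hG : Measurable G) {V : ℝ≥0∞}
    (hV : ∀ j, ∫⁻ ω, (‖G (z (j + 1) ω)‖ₑ * sojourn (avgWeight w (z (j + 1) ω))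
      (fun i => avgWeight w (z (j + 1 + i + 1) ω)) (fun i => u (j + 1 + i) ω)) ^ s ∂P ≤ V)
    {ρ : ℕ → ℝ≥0∞}
    (hρ : ∀ j, P {ω | Waits (avgWeight w (z 0 ω)) (fun i => avgWeight w (z (i + 1) ω))
      (fun i => u i ω) j} ≤ ρ j) :
    (∫⁻ ω, (∑' j, (if Waits (avgWeight w (z 0 ω)) (fun i => avgWeight w (z (i + 1) ω))
      (fun i => u i ω) j then 1 else 0) * (‖G (z (j + 1) ω)‖ₑ *
        sojourn (avgWeight w (z (j + 1) ω)) (fun i => avgWeight w (z (j + 1 + i + 1) ω))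
          (fun i => u (j + 1 + i) ω))) ^ s ∂P) ^ (1 / s)
      ≤ (∑' j, ρ j ^ (1 / s)) * V ^ (1 / s) := by
  have hs0 : 0 < s := by linarith
  have mA := measurable_avgWeight (N := N) hw
  have mb : ∀ i, Measurable fun ω => avgWeight w (z i ω) := fun i => mA.comp (h.measurable_z i)
  have m1 : ∀ j, Measurable fun ω => if Waits (avgWeight w (z 0 ω))
      (fun i => avgWeight w (z (i + 1) ω)) (fun i => u i ω) j then (1 : ℝ≥0∞) else 0 := fun j =>
    measurable_ite_waits (mb 0) (fun i _ => mb (i + 1)) fun i _ => h.measurable_u i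
  have m2 : ∀ j, Measurable fun ω => ‖G (z (j + 1) ω)‖ₑ * sojourn (avgWeight w (z (j + 1) ω))
      (fun i => avgWeight w (z (j + 1 + i + 1) ω)) (fun i => u (j + 1 + i) ω) := fun j =>
    (hG.comp (h.measurable_z _)).enorm.mul
      (measurable_sojourn (mb _) (fun i => mb _) fun i => h.measurable_u _)
  have key := ENNReal.rpow_le_rpow (z := 1 / s)
    (lintegral_tsum_rpow_le (μ := P) hs fun j => (m1 j).mul (m2 j)) (by positivity)
  rw [← ENNReal.rpow_mul, mul_one_div_cancel hs0.ne', ENNReal.rpow_one] at key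
  refine key.trans ?_
  rw [← ENNReal.tsum_mul_right]
  refine ENNReal.tsum_le_tsum fun j => ?_
  rw [← ENNReal.mul_rpow_of_nonneg _ _ (by positivity : 0 ≤ 1 / s)]
  refine ENNReal.rpow_le_rpow ?_ (by positivity)
  simp only [Pi.mul_apply, ENNReal.mul_rpow_of_nonneg _ _ hs0.le]
  -- The waiting event uses `z 0, …, z j` and `u 0, …, u (j - 1)`. The sojourn uses particles from
  -- `z (j + 1)` and uniforms from `u (j + 1)`; the draw `u j` enters neither.
  set S : Set (ℕ ⊕ ℕ) := {i | Sum.elim (fun t => t ≤ j) (fun t => t < j) i} with hS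
  have hz0 : ∀ t ≤ j, Sum.inl t ∈ S := fun t ht => ht
  have hu0 : ∀ t < j, Sum.inr t ∈ S := fun t ht => ht
  have hz1 : ∀ t, j < t → Sum.inl t ∈ Sᶜ := fun t ht => not_le.2 ht
  have hu1 : ∀ t, j ≤ t → Sum.inr t ∈ Sᶜ := fun t ht => not_lt.2 ht
  have ind : IndepFun (fun ω => (if Waits (avgWeight w (z 0 ω))
      (fun i => avgWeight w (z (i + 1) ω)) (fun i => u i ω) j then (1 : ℝ≥0∞) else 0) ^ s)
      (fun ω => (‖G (z (j + 1) ω)‖ₑ * sojourn (avgWeight w (z (j + 1) ω))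
        (fun i => avgWeight w (z (j + 1 + i + 1) ω)) (fun i => u (j + 1 + i) ω)) ^ s) P := by
    refine h.indepFun_of_disjoint (S := S) (T := Sᶜ) disjoint_compl_right ?_ ?_
    · exact (@measurable_ite_waits _ (_) _ _ _ _ (mA.comp (measurable_draw_z (hz0 0 (Nat.zero_le j))))
        (fun i hi => mA.comp (measurable_draw_z (hz0 _ hi)))
        fun i hi => measurable_draw_u (hu0 _ hi)).pow_const s
    · exact ((measurable_enorm.comp (hG.comp (measurable_draw_z (hz1 _ (Nat.lt_succ_self j))))).mul
        (@measurable_sojourn _ (_) _ _ _ (mA.comp (measurable_draw_z (hz1 _ (Nat.lt_succ_self j))))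
          (fun i => mA.comp (measurable_draw_z (hz1 _ (by omega))))
          fun i => measurable_draw_u (hu1 _ (by omega)))).pow_const s
  have e := lintegral_mul_eq_lintegral_mul_lintegral_of_indepFun'' ((m1 j).pow_const s).aemeasurable
    ((m2 j).pow_const s).aemeasurable ind
  simp only [ENNReal.mul_rpow_of_nonneg _ _ hs0.le] at e hV
  rw [e]
  refine mul_le_mul' ?_ (hV j)
  refine le_trans (le_of_eq ?_) (hρ j)
  rw [← lintegral_indicator_one (measurableSet_waits (mb 0) (fun i _ => mb (i + 1))
      fun i _ => h.measurable_u i)]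
  refine lintegral_congr fun ω => ?_
  by_cases hc : Waits (avgWeight w (z 0 ω)) (fun i => avgWeight w (z (i + 1) ω))
      (fun i => u i ω) j <;> simp [hc, hs0]

/-- **Moment bound for the unbiased importance sampling estimator.** -/
theorem IsUISInput.integral_abs_uis_sub_rpow_le (h : IsUISInput q P z u) [IsProbabilityMeasure P]
    [IsProbabilityMeasure q] {s p r Aw Af Ah : ℝ} (hs : 2 ≤ s)
    (hsp : s < p) (hsr : s < r) (hspr : s * (p + r + 2) ≤ p * r) (hw : Measurable w)
    (hf : Measurable f) (hw0 : ∀ᵐ x ∂q, 0 < w x) (hw1 : ∫ x, w x ∂q = 1)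
    (iw : Integrable (fun x => |w x| ^ p) q) (jf : Integrable (fun x => |f x| ^ r) q)
    (ih : Integrable (fun x => |w x * f x| ^ s) q) (bw : ∫ x, |w x| ^ p ∂q ≤ Aw)
    (bf : ∫ x, |f x| ^ r ∂q ≤ Af) (bh : ∫ x, |w x * f x| ^ s ∂q ≤ Ah) (hN : 1 ≤ N) :
    (∀ᵐ ω ∂P, meetingTime w (fun t => z t ω) (fun t => u t ω) < ⊤) ∧
      Integrable (fun ω =>
        |uis w f (fun t => z t ω) (fun t => u t ω) - ∫ x, w x * f x ∂q| ^ s) P ∧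
      ∫ ω, |uis w f (fun t => z t ω) (fun t => u t ω) - ∫ x, w x * f x ∂q| ^ s ∂P
        ≤ uisConst s p r Aw Af Ah * (N : ℝ) ^ (-s / 2) := by
  classical
  obtain ⟨iG, bG⟩ := integral_abs_snis_sub_rpow_le hs hsp hsr hspr hw hf hw0 hw1 iw jf ih bw bf bh hN
  set c := ∫ x, w x * f x ∂q with hc
  have hs0 : 0 < s := by linarith
  have hp0 : 0 < p := by linarith
  have hAw : 0 ≤ Aw := le_trans (integral_nonneg fun x => by positivity) bw
  have hκ := le_integral_min_one_avgWeight (by linarith) hw hw0 hw1 iw bw hN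
  set κ := 3 / (4 * (1 + Aw)) with hκdef
  have hκ0 : 0 < κ := by positivity
  have hκ1 : κ ≤ 1 := by rw [hκdef, div_le_one (by positivity)]; linarith
  have mA := measurable_avgWeight (N := N) hw
  have mS := measurable_snis (N := N) hw hf
  have mG : Measurable fun x : Fin N → X => snis w f x - c := mS.sub_const c
  set D := (p / κ) ^ p * (1 + Aw) with hD
  have hD0 : 0 ≤ D := by positivity
  set M := ∫ x, (|snis w f x - c| ^ s + |avgWeight w x * (snis w f x - c)| ^ s)
    ∂(Measure.pi fun _ : Fin N => q) with hM
  have hM0 : 0 ≤ M := integral_nonneg fun x => by positivity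
  have htail : ∀ j, 1 ≤ j → P {ω | Waits (avgWeight w (z 0 ω))
      (fun i => avgWeight w (z (i + 1) ω)) (fun i => u i ω) j} ≤ ENNReal.ofReal (D * (j : ℝ) ^ (-p)) :=
    fun j hj => h.measure_waits_zero_le hw hw0 hN hκ0 hκ1 hκ (by linarith) iw bw hj
  -- acceptance happens eventually
  have hacc : ∀ᵐ ω ∂P, ∃ T, ¬ Waits (avgWeight w (z 0 ω)) (fun i => avgWeight w (z (i + 1) ω))
      (fun i => u i ω) T := by
    rw [ae_iff]
    simp only [not_exists, not_not]
    have hlim : Filter.Tendsto (fun j : ℕ => ENNReal.ofReal (D * (j : ℝ) ^ (-p))) Filter.atTop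
        (nhds 0) := by
      rw [← ENNReal.ofReal_zero]
      refine ENNReal.tendsto_ofReal ?_
      simpa using ((tendsto_rpow_neg_atTop hp0).comp tendsto_natCast_atTop_atTop).const_mul D
    refine le_antisymm (ge_of_tendsto hlim ?_) zero_le
    filter_upwards [Filter.eventually_ge_atTop 1] with j hj
    refine le_trans (measure_mono ?_) (htail j hj)
    exact Set.ofPred_subset_ofPred.2 fun ω hω => hω j
  have hpath : ∀ᵐ ω ∂P, (∃ T, (laggedPair w (fun t => z t ω) (fun t => u t ω) T).1
      = (laggedPair w (fun t => z t ω) (fun t => u t ω) T).2) ∧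
      ‖uis w f (fun t => z t ω) (fun t => u t ω) - c‖ₑ ≤ ‖snis w f (z 0 ω) - c‖ₑ *
        sojourn (avgWeight w (z 0 ω)) (fun i => avgWeight w (z (i + 1) ω)) (fun i => u i ω) +
      ∑' j, (if Waits (avgWeight w (z 0 ω)) (fun i => avgWeight w (z (i + 1) ω))
        (fun i => u i ω) j then 1 else 0) * (‖snis w f (z (j + 1) ω) - c‖ₑ *
          sojourn (avgWeight w (z (j + 1) ω)) (fun i => avgWeight w (z (j + 1 + i + 1) ω))
            (fun i => u (j + 1 + i) ω)) := by
    filter_upwards [h.ae_draws hN hw0, hacc] with ω h1 h2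
    exact enorm_uis_sub_le h1.1 h1.2.1 h1.2.2 h2 c
  -- The estimator is almost surely the eventually constant limit of sums cut at a deterministic
  -- time, which avoids measurability of the meeting time.
  have mU : AEStronglyMeasurable (fun ω => uis w f (fun t => z t ω) (fun t => u t ω)) P := by
    refine aestronglyMeasurable_of_tendsto_ae Filter.atTop (f := fun n ω => snis w f (z 0 ω) +
      ∑ k ∈ Finset.range n, (snis w f (laggedPair w (fun t => z t ω) (fun t => u t ω) k).1
        - snis w f (laggedPair w (fun t => z t ω) (fun t => u t ω) k).2)) (fun n => ?_) ?_
    · refine Measurable.aestronglyMeasurable ?_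
      refine (mS.comp (h.measurable_z 0)).add (Finset.measurable_sum _ fun k _ => ?_)
      have := measurable_laggedPair hw h.measurable_z h.measurable_u k
      exact (mS.comp this.fst).sub (mS.comp this.snd)
    · filter_upwards [hpath] with ω hω
      obtain ⟨T, hT⟩ := hω.1
      refine tendsto_const_nhds.congr' ?_
      filter_upwards [Filter.eventually_ge_atTop T] with n hn
      exact uis_eq_sum_range hT hn
  set V : ℝ≥0∞ := ENNReal.ofReal ((s / κ) ^ s * M) with hV
  have b0 := h.lintegral_enorm_mul_sojourn_rpow_le hw hw0 hN hκ0 hκ1 hκ (s := s) (by linarith) mG iG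
  have b1 : ∀ j, ∫⁻ ω, (‖snis w f (z (j + 1) ω) - c‖ₑ * sojourn (avgWeight w (z (j + 1) ω))
      (fun i => avgWeight w (z (j + 1 + i + 1) ω)) (fun i => u (j + 1 + i) ω)) ^ s ∂P ≤ V := fun j =>
    (h.shift (j + 1)).lintegral_enorm_mul_sojourn_rpow_le hw hw0 hN hκ0 hκ1 hκ (s := s)
      (by linarith) mG iG
  have b2 := h.lintegral_tsum_sojourn_rpow_le hw (s := s) (by linarith) mG b1
    (ρ := fun j => if j = 0 then 1 else ENNReal.ofReal (D * (j : ℝ) ^ (-p))) (fun j => by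
      rcases Nat.eq_zero_or_pos j with rfl | hj
      · simpa using prob_le_one
      · simpa [hj.ne'] using htail j hj)
  have mb : ∀ i, Measurable fun ω => avgWeight w (z i ω) := fun i => mA.comp (h.measurable_z i)
  have m0 : Measurable fun ω => ‖snis w f (z 0 ω) - c‖ₑ * sojourn (avgWeight w (z 0 ω))
      (fun i => avgWeight w (z (i + 1) ω)) (fun i => u i ω) :=
    (mG.comp (h.measurable_z 0)).enorm.mul
      (measurable_sojourn (mb 0) (fun i => mb (i + 1)) fun i => h.measurable_u i)
  have m1 : Measurable fun ω => ∑' j, (if Waits (avgWeight w (z 0 ω))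
      (fun i => avgWeight w (z (i + 1) ω)) (fun i => u i ω) j then (1 : ℝ≥0∞) else 0) *
      (‖snis w f (z (j + 1) ω) - c‖ₑ * sojourn (avgWeight w (z (j + 1) ω))
        (fun i => avgWeight w (z (j + 1 + i + 1) ω)) (fun i => u (j + 1 + i) ω)) :=
    Measurable.tsum fun j => (measurable_ite_waits (mb 0) (fun i _ => mb (i + 1))
      fun i _ => h.measurable_u i).mul ((mG.comp (h.measurable_z _)).enorm.mul
        (measurable_sojourn (mb _) (fun i => mb _) fun i => h.measurable_u _))
  have key : (∫⁻ ω, ‖uis w f (fun t => z t ω) (fun t => u t ω) - c‖ₑ ^ s ∂P) ^ (1 / s)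
      ≤ tailSum D p s * V ^ (1 / s) := by
    refine (ENNReal.rpow_le_rpow (lintegral_mono_ae (hpath.mono fun ω hω =>
      ENNReal.rpow_le_rpow hω.2 hs0.le)) (by positivity)).trans ?_
    refine (ENNReal.lintegral_Lp_add_le m0.aemeasurable m1.aemeasurable (by linarith)).trans ?_
    refine (add_le_add (ENNReal.rpow_le_rpow b0 (by positivity)) b2).trans (le_of_eq ?_)
    -- The `2` in `tailSum` collects the sojourn of the leading chain and the term `j = 0`, whose
    -- waiting event is certain.
    rw [tsum_eq_zero_add' ENNReal.summable]
    unfold tailSum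
    simp only [if_true, ENNReal.one_rpow, Nat.succ_ne_zero, if_false]
    ring
  have key2 : ∫⁻ ω, ‖uis w f (fun t => z t ω) (fun t => u t ω) - c‖ₑ ^ s ∂P
      ≤ ENNReal.ofReal ((s / κ) ^ s * M * (tailSum D p s ^ s).toReal) := by
    have := ENNReal.rpow_le_rpow key hs0.le
    rw [← ENNReal.rpow_mul, one_div_mul_cancel hs0.ne', ENNReal.rpow_one,
      ENNReal.mul_rpow_of_nonneg _ _ hs0.le, ← ENNReal.rpow_mul, one_div_mul_cancel hs0.ne',
      ENNReal.rpow_one] at this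
    refine this.trans (le_of_eq ?_)
    rw [ENNReal.ofReal_mul (by positivity), ENNReal.ofReal_toReal
      (ENNReal.rpow_ne_top_of_nonneg hs0.le (tailSum_ne_top hD0 hs0 hsp)), mul_comm]
  have eU : ∀ ω, ‖|uis w f (fun t => z t ω) (fun t => u t ω) - c| ^ s‖ₑ
      = ‖uis w f (fun t => z t ω) (fun t => u t ω) - c‖ₑ ^ s := fun ω => by
    rw [Real.enorm_eq_ofReal_abs (uis _ _ _ _ - c), ENNReal.ofReal_rpow_of_nonneg (abs_nonneg _) hs0.le,
      Real.enorm_eq_ofReal (by positivity)]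
  have mU' : AEStronglyMeasurable (fun ω =>
      |uis w f (fun t => z t ω) (fun t => u t ω) - c| ^ s) P := by
    have := ((mU.aemeasurable.sub_const c).norm.pow_const s).aestronglyMeasurable
    simpa only [Real.norm_eq_abs] using this
  refine ⟨hpath.mono fun ω hω => hω.1.elim fun T hT => meetingTime_lt_top hT, ⟨mU', ?_⟩, ?_⟩
  · rw [hasFiniteIntegral_iff_enorm]
    simp only [eU]
    exact key2.trans_lt ENNReal.ofReal_lt_top
  · rw [integral_eq_lintegral_of_nonneg_ae (ae_of_all _ fun ω => by positivity) mU']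
    have e2 : ∫⁻ ω, ENNReal.ofReal (|uis w f (fun t => z t ω) (fun t => u t ω) - c| ^ s) ∂P
        ≤ ENNReal.ofReal ((s / κ) ^ s * M * (tailSum D p s ^ s).toReal) := by
      refine le_trans (le_of_eq (lintegral_congr fun ω => ?_)) key2
      rw [← eU, Real.enorm_eq_ofReal (by positivity)]
    refine (ENNReal.toReal_le_of_le_ofReal (by positivity) e2).trans ?_
    have : (s / κ) ^ s * M * (tailSum D p s ^ s).toReal
        ≤ (s / κ) ^ s * (momentConst s p r Aw Af Ah * (N : ℝ) ^ (-s / 2))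
          * (tailSum D p s ^ s).toReal := by gcongr
    refine this.trans (le_of_eq ?_)
    unfold uisConst
    ring

end Core

/-! ### Change of measure and choice of exponents -/

section Weight

variable {X : Type*} [MeasurableSpace X] {π q : Measure X} {w f : X → ℝ}

lemma IsImportanceWeight.integral_eq (h : IsImportanceWeight π q w) (g : X → ℝ) :
    ∫ x, g x ∂π = ∫ x, w x * g x ∂q := by
  rw [h.density, integral_withDensity_eq_integral_toReal_smul h.measurable.ennreal_ofReal
    (ae_of_all _ fun x => ENNReal.ofReal_lt_top)]
  refine integral_congr_ae (h.pos.mono fun x hx => ?_)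
  simp [ENNReal.toReal_ofReal hx.le]

lemma IsImportanceWeight.integral_weight [IsProbabilityMeasure π] (h : IsImportanceWeight π q w) :
    ∫ x, w x ∂q = 1 := by
  simpa using (h.integral_eq fun _ => 1).symm

lemma IsImportanceWeight.ae_abs_rpow (h : IsImportanceWeight π q w) (p : ℝ) :
    (fun x => |w x| ^ p) =ᵐ[q] fun x => w x ^ p :=
  h.pos.mono fun x hx => by simp only [abs_of_pos hx]

end Weight

/-- Young's inequality with the conjugate exponents `p / s` and `p / (p - s)`. -/
lemma abs_mul_rpow_le_add {p s a b : ℝ} (hs : 0 < s) (hsp : s < p) :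
    |a * b| ^ s ≤ |a| ^ p + |b| ^ (p * s / (p - s)) := by
  have hps : 0 < p - s := by linarith
  have hp : 0 < p := by linarith
  have hc : (p / s).HolderConjugate (p / (p - s)) := by
    rw [Real.holderConjugate_iff]
    exact ⟨(one_lt_div hs).2 hsp, by field_simp; ring⟩
  have hy := Real.young_inequality_of_nonneg (a := |a| ^ s) (b := |b| ^ s) (by positivity)
    (by positivity) hc
  rw [← Real.rpow_mul (abs_nonneg _), ← Real.rpow_mul (abs_nonneg _),
    ← Real.mul_rpow (abs_nonneg _) (abs_nonneg _), ← abs_mul,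
    show s * (p / s) = p by field_simp, show s * (p / (p - s)) = p * s / (p - s) by ring] at hy
  refine hy.trans (add_le_add (div_le_self (by positivity) hc.lt.le)
    (div_le_self (by positivity) hc.symm.lt.le))

theorem mainTheorem10 :
    (∀ p r s : ℝ, 2 < p → 2 ≤ r → 2 ≤ s → s < p →
      p * s / (p - s) < p * r / (p + r + 2) →
      ∃ C : ℝ → ℝ → ℝ → ℝ,
        ∀ (X : Type*) [MeasurableSpace X] (π q : Measure X)
          [IsProbabilityMeasure π] [IsProbabilityMeasure q] (w f : X → ℝ),
          IsImportanceWeight π q w → Measurable f →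
          Integrable (fun x => w x ^ p) q →
          Integrable (fun x => |f x| ^ r) q →
          Integrable (fun x => f x ^ 2 * w x ^ 2) q →
          ∀ (N : ℕ), 1 ≤ N →
          ∀ (Ω : Type*) [MeasurableSpace Ω] (P : Measure Ω) [IsProbabilityMeasure P]
            (z : ℕ → Ω → Fin N → X) (u : ℕ → Ω → ℝ), IsUISInput q P z u →
            (∀ᵐ ω ∂P, meetingTime w (fun t => z t ω) (fun t => u t ω) < ⊤) ∧
            Integrable (fun ω =>
              |uis w f (fun t => z t ω) (fun t => u t ω) - ∫ x, f x ∂π| ^ s) P ∧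
            ∫ ω, |uis w f (fun t => z t ω) (fun t => u t ω) - ∫ x, f x ∂π| ^ s ∂P
              ≤ C (∫ x, |f x| ^ r ∂q) (∫ x, w x ^ p ∂q) (∫ x, f x ^ 2 * w x ^ 2 ∂q)
                * (N : ℝ) ^ (-s / 2)) ∧
    (∀ p s : ℝ, 2 < p → 0 < s → s < p → s * p / (p - s) < p →
      ∃ C : ℝ → ℝ → ℝ → ℝ,
        ∀ (X : Type*) [MeasurableSpace X] (π q : Measure X)
          [IsProbabilityMeasure π] [IsProbabilityMeasure q] (w f : X → ℝ) (B : ℝ),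
          IsImportanceWeight π q w → Measurable f →
          Integrable (fun x => w x ^ p) q →
          (∀ᵐ x ∂q, |f x| ≤ B) →
          ∀ (N : ℕ), 1 ≤ N →
          ∀ (Ω : Type*) [MeasurableSpace Ω] (P : Measure Ω) [IsProbabilityMeasure P]
            (z : ℕ → Ω → Fin N → X) (u : ℕ → Ω → ℝ), IsUISInput q P z u →
            (∀ᵐ ω ∂P, meetingTime w (fun t => z t ω) (fun t => u t ω) < ⊤) ∧
            Integrable (fun ω =>
              |uis w f (fun t => z t ω) (fun t => u t ω) - ∫ x, f x ∂π| ^ s) P ∧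
            ∫ ω, |uis w f (fun t => z t ω) (fun t => u t ω) - ∫ x, f x ∂π| ^ s ∂P
              ≤ C B (∫ x, w x ^ p ∂q) (∫ x, f x ^ 2 * w x ^ 2 ∂q)
                * (N : ℝ) ^ (-s / 2)) := by
  refine ⟨fun p r s hp hr hs hsp hspr => ?_, fun p s hp hs hsp _ => ?_⟩
  · have hps : 0 < p - s := by linarith
    have hs0 : 0 < s := by linarith
    have hd : 0 < p + r + 2 := by linarith
    -- The exponent hypothesis serves twice. Weakened to `s ≤ p r / (p + r + 2)` it is the balance
    -- condition for `L`; weakened to `p s / (p - s) ≤ r` it puts `w f` in `L^s`.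
    have he : s ≤ p * s / (p - s) := by
      rw [le_div_iff₀ hps]; nlinarith
    have hcond : s * (p + r + 2) ≤ p * r := by
      rw [← le_div_iff₀ hd]; linarith
    have her : p * s / (p - s) ≤ r := by
      refine hspr.le.trans ?_
      rw [div_le_iff₀ hd]; nlinarith
    have hsr : s < r := by nlinarith
    refine ⟨fun Af Aw _ => uisConst s p r Aw Af (Aw + (1 + Af)), ?_⟩
    intro X _ π q _ _ w f hw hf iw jf _ N hN Ω _ P _ z u h
    have iw' : Integrable (fun x => |w x| ^ p) q := iw.congr (hw.ae_abs_rpow p).symm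
    have bw' : ∫ x, |w x| ^ p ∂q = ∫ x, w x ^ p ∂q := integral_congr_ae (hw.ae_abs_rpow p)
    have hdom : ∀ x, |w x * f x| ^ s ≤ |w x| ^ p + (1 + |f x| ^ r) := fun x =>
      (abs_mul_rpow_le_add hs0 hsp).trans (add_le_add_right
        (rpow_le_one_add_rpow (abs_nonneg _) (by linarith) her) _)
    have i1 : Integrable (fun x => 1 + |f x| ^ r) q := (integrable_const _).add jf
    have iD : Integrable (fun x => |w x| ^ p + (1 + |f x| ^ r)) q := iw'.add i1
    have ih : Integrable (fun x => |w x * f x| ^ s) q :=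
      iD.mono' ((hw.measurable.mul hf).abs.pow_const s).aestronglyMeasurable
        (ae_of_all _ fun x => by rw [Real.norm_of_nonneg (by positivity)]; exact hdom x)
    have bh : ∫ x, |w x * f x| ^ s ∂q ≤ ∫ x, w x ^ p ∂q + (1 + ∫ x, |f x| ^ r ∂q) := by
      refine (integral_mono ih iD hdom).trans (le_of_eq ?_)
      rw [integral_add iw' i1, bw', integral_add (integrable_const _) jf, integral_const, probReal_univ, one_smul]
    rw [hw.integral_eq]
    exact h.integral_abs_uis_sub_rpow_le hs hsp hsr hcond hw.measurable hf hw.pos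
      hw.integral_weight iw' jf ih bw'.le le_rfl bh hN
  -- The moment bound needs an exponent of at least `2`; smaller `s` is recovered at the end by
  -- Jensen's inequality.
  · set t := max s 2 with ht
    have ht2 : 2 ≤ t := le_max_right _ _
    have ht0 : 0 < t := by linarith
    have hst : s ≤ t := le_max_left _ _
    have htp : t < p := max_lt hsp hp
    have hpt : 0 < p - t := by linarith
    -- A bounded `f` has all moments, so `r` is free; this value gives equality in the balance
    -- condition `t (p + r + 2) ≤ p r`.
    set r := t * (p + 2) / (p - t) with hr
    have hrp : r * (p - t) = t * (p + 2) := by rw [hr]; field_simp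
    have htr : t < r := by rw [hr, lt_div_iff₀ hpt]; nlinarith
    have hcond : t * (p + r + 2) ≤ p * r := by linarith
    refine ⟨fun B Aw _ => uisConst t p r Aw (|B| ^ r) (|B| ^ t * (1 + Aw)) ^ (s / t), ?_⟩
    intro X _ π q _ _ w f B hw hf iw hB N hN Ω _ P _ z u h
    have iw' : Integrable (fun x => |w x| ^ p) q := iw.congr (hw.ae_abs_rpow p).symm
    have bw' : ∫ x, |w x| ^ p ∂q = ∫ x, w x ^ p ∂q := integral_congr_ae (hw.ae_abs_rpow p)
    have hB' : ∀ᵐ x ∂q, |f x| ≤ |B| := hB.mono fun x hx => hx.trans (le_abs_self B)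
    have hfr : ∀ᵐ x ∂q, |f x| ^ r ≤ |B| ^ r := hB'.mono fun x hx =>
      Real.rpow_le_rpow (abs_nonneg _) hx (by linarith)
    have jf : Integrable (fun x => |f x| ^ r) q :=
      (integrable_const (|B| ^ r)).mono' (hf.abs.pow_const r).aestronglyMeasurable
        (hfr.mono fun x hx => by rwa [Real.norm_of_nonneg (by positivity)])
    have bf : ∫ x, |f x| ^ r ∂q ≤ |B| ^ r := by
      simpa using integral_mono_ae jf (integrable_const (|B| ^ r)) hfr
    have hdom : ∀ᵐ x ∂q, |w x * f x| ^ t ≤ |B| ^ t * (1 + |w x| ^ p) := hB'.mono fun x hx => by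
      rw [abs_mul, Real.mul_rpow (abs_nonneg _) (abs_nonneg _), mul_comm]
      gcongr
      exact rpow_le_one_add_rpow (abs_nonneg _) ht0.le htp.le
    have iD : Integrable (fun x => |B| ^ t * (1 + |w x| ^ p)) q :=
      ((integrable_const _).add iw').const_mul _
    have ih : Integrable (fun x => |w x * f x| ^ t) q :=
      iD.mono' ((hw.measurable.mul hf).abs.pow_const t).aestronglyMeasurable
        (hdom.mono fun x hx => by rwa [Real.norm_of_nonneg (by positivity)])
    have bh : ∫ x, |w x * f x| ^ t ∂q ≤ |B| ^ t * (1 + ∫ x, w x ^ p ∂q) := by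
      refine (integral_mono_ae ih iD hdom).trans (le_of_eq ?_)
      rw [integral_const_mul, integral_add (integrable_const _) iw', integral_const,
        probReal_univ, one_smul, bw']
    rw [hw.integral_eq]
    obtain ⟨h1, h2, h3⟩ := h.integral_abs_uis_sub_rpow_le ht2 htp htr hcond hw.measurable hf hw.pos
      hw.integral_weight iw' jf ih bw'.le bf bh hN
    have hN0 : (0 : ℝ) < N := by exact_mod_cast hN
    -- Jensen raises the bound of order `t` to the power `s / t`, and `(N ^ (-t / 2)) ^ (s / t)` is
    -- the required rate.
    refine ⟨h1, integrable_abs_rpow_of_le hs.le hst h2,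
      (integral_abs_rpow_le hs.le hst ht0 h2).trans ?_⟩
    have hK : 0 ≤ uisConst t p r (∫ x, w x ^ p ∂q) (|B| ^ r) (|B| ^ t * (1 + ∫ x, w x ^ p ∂q)) := by
      have := (integral_nonneg fun ω => by positivity).trans h3
      exact nonneg_of_mul_nonneg_left this (by positivity)
    refine (Real.rpow_le_rpow (integral_nonneg fun ω => by positivity) h3 (by positivity)).trans
      (le_of_eq ?_)
    rw [Real.mul_rpow hK (by positivity), ← Real.rpow_mul hN0.le]
    congr 2
    field_simp
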